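/- Let $n\ge 1$ be an integer, $s\in(0,1]$ and $1\le p<\infty$ with $s\,p>n$, and set $\alpha=s-\frac np$. For $u:\mathbb R^n\to\mathbb R$ put $$[u]_{W^{s,p}(\mathbb R^n)}=\Big(s(1-s)\iint_{\mathbb R^n\times\mathbb R^n}\frac{|u(x)-u(y)|^p}{|x-y|^{n+sp}}\,dx\,dy\Big)^{1/p}\quad(0<s<1),\qquad [u]_{W^{1,p}(\mathbb R^n)}=\|\nabla u\|_{L^p(\mathbb R^n)},$$ where $\nabla u$ is the weak gradient (and $[u]_{W^{1,p}(\mathbb R^n)}=+\infty$ if $u$ has no weak gradient in $L^p$). Let $\mathcal D^{s,p}(\mathbb R^n)$ be the completion of $C_c^\infty(\mathbb R^n)$ with respect to $[\,\cdot\,]_{W^{s,p}(\mathbb R^n)}$, i.e. the space of Cauchy sequences $(u_m)$ in $C_c^\infty(\mathbb R^n)$ modulo sequences with $[u_m]_{W^{s,p}(\mathbb R^n)}\to0$, with the norm $\lim_{m\to\infty}[u_m]_{W^{s,p}(\mathbb R^n)}$. Let $$\dot W^{s,p}(\mathbb R^n)=\Big\{u\in C^{0,\alpha}(\mathbb R^n):[u]_{W^{s,p}(\mathbb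 R^n)}<+\infty\Big\}\Big/\sim_C,\qquad u\sim_C v\iff u-v\text{ is constant},$$ where $C^{0,\alpha}(\mathbb R^n)$ is the set of all (possibly unbounded) $u:\mathbb R^n\to\mathbb R$ with $\sup_{x\ne y}|u(x)-u(y)|/|x-y|^\alpha<+\infty$. Write $\{u\}_C$ for the class of $u$ and set $\|\{u\}_C\|_{\dot W^{s,p}(\mathbb R^n)}=[u]_{W^{s,p}(\mathbb R^n)}$. Then $\dot W^{s,p}(\mathbb R^n)$ with this norm is a Banach space, and there is a linear isometric isomorphism (in particular, a surjective one) $$\mathcal J:\mathcal D^{s,p}(\mathbb R^n)\to\dot W^{s,p}(\mathbb R^n)$$ that sends the element of $\mathcal D^{s,p}(\mathbb R^n)$ given by a test function $\varphi\in C_c^\infty(\mathbb R^n)$ to $\{\varphi\}_C$. -/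

import Mathlib

open MeasureTheory
open scoped ENNReal NNReal

noncomputable section

namespace HomogeneousSobolev

/-- Smooth compactly supported real functions on `ℝⁿ` (a function is `C^∞`, not analytic). -/
def IsTest {n : ℕ} (φ : EuclideanSpace ℝ (Fin n) → ℝ) : Prop :=
  ContDiff ℝ ((⊤ : ℕ∞) : WithTop ℕ∞) φ ∧ HasCompactSupport φ

/-- `G` is the weak (distributional) gradient of the locally integrable function `u`:
`∫ u ∂ᵢφ = - ∫ Gᵢ φ` for all test functions `φ` and all coordinates `i`. -/
structure IsWeakGradient {n : ℕ} (u : EuclideanSpace ℝ (Fin n) → ℝ)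
    (G : EuclideanSpace ℝ (Fin n) → EuclideanSpace ℝ (Fin n)) : Prop where
  locallyIntegrable : LocallyIntegrable u volume
  locallyIntegrable_grad : LocallyIntegrable G volume
  integral_eq : ∀ φ : EuclideanSpace ℝ (Fin n) → ℝ, IsTest φ → ∀ i : Fin n,
    ∫ x, u x * fderiv ℝ φ x (EuclideanSpace.single i 1) = -∫ x, G x i * φ x

/-- `‖∇u‖_{L^p}`, with value `∞` if `u` has no weak gradient in `L^p`. The weak gradient is unique up
to null sets, so the infimum is over a family of equal numbers. -/
def gradSeminorm (n : ℕ) (p : ℝ) (u : EuclideanSpace ℝ (Fin n) → ℝ) : ℝ≥0∞ :=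
  ⨅ (G : EuclideanSpace ℝ (Fin n) → EuclideanSpace ℝ (Fin n)) (_ : IsWeakGradient u G),
    eLpNorm G (ENNReal.ofReal p) volume

/-- The double integral `∬ |u(x) - u(y)|^p / |x - y|^(n + s p) dx dy`. -/
def gagliardoIntegral (n : ℕ) (s p : ℝ) (u : EuclideanSpace ℝ (Fin n) → ℝ) : ℝ≥0∞ :=
  ∫⁻ z : EuclideanSpace ℝ (Fin n) × EuclideanSpace ℝ (Fin n),
    ‖u z.1 - u z.2‖ₑ ^ p / ‖z.1 - z.2‖ₑ ^ ((n : ℝ) + s * p)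

/-- The normalized Gagliardo–Slobodeckij seminorm `[u]_{W^{s,p}(ℝⁿ)}` for `s ∈ (0, 1]`, with values
in `[0, ∞]`: for `s = 1` it is `‖∇u‖_{L^p}`. -/
def gagliardo (n : ℕ) (s p : ℝ) (u : EuclideanSpace ℝ (Fin n) → ℝ) : ℝ≥0∞ :=
  if s = 1 then gradSeminorm n p u
  else (ENNReal.ofReal (s * (1 - s)) * gagliardoIntegral n s p u) ^ (1 / p)

/-- The standing assumptions `n ≥ 1`, `0 < s ≤ 1`, `1 ≤ p < ∞`. -/
structure Exponents (n : ℕ) (s p : ℝ) : Prop where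
  one_le_n : 1 ≤ n
  s_pos : 0 < s
  s_le_one : s ≤ 1
  one_le_p : 1 ≤ p

/-! ### Elementary properties of the seminorm -/

section Aux

variable {n : ℕ} {s p : ℝ} {u v : EuclideanSpace ℝ (Fin n) → ℝ}

theorem IsTest.add (hu : IsTest u) (hv : IsTest v) : IsTest (u + v) :=
  ⟨hu.1.add hv.1, hu.2.add hv.2⟩

theorem IsTest.smul (c : ℝ) (hu : IsTest u) : IsTest (c • u) :=
  ⟨hu.1.const_smul c, hu.2.smul_left (f := fun _ => c)⟩

theorem IsTest.zero : IsTest (0 : EuclideanSpace ℝ (Fin n) → ℝ) :=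
  ⟨contDiff_const, HasCompactSupport.zero⟩

theorem IsTest.continuous (hu : IsTest u) : Continuous u := hu.1.continuous

theorem IsTest.continuous_partial (hu : IsTest u) (w : EuclideanSpace ℝ (Fin n)) :
    Continuous (fun x => fderiv ℝ u x w) :=
  (hu.1.continuous_fderiv (by simp)).clm_apply continuous_const

theorem IsTest.hasCompactSupport_partial (hu : IsTest u) (w : EuclideanSpace ℝ (Fin n)) :
    HasCompactSupport (fun x => fderiv ℝ u x w) :=
  hu.2.fderiv_apply ℝ w

theorem integrable_mul_test {g φ : EuclideanSpace ℝ (Fin n) → ℝ} (hg : LocallyIntegrable g volume)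
    (hφ : Continuous φ) (hc : HasCompactSupport φ) : Integrable (fun x => g x * φ x) volume := by
  have := hg.integrable_smul_left_of_hasCompactSupport hφ hc
  simpa [mul_comm] using this

theorem locallyIntegrable_coord {G : EuclideanSpace ℝ (Fin n) → EuclideanSpace ℝ (Fin n)}
    (hG : LocallyIntegrable G volume) (i : Fin n) : LocallyIntegrable (fun x => G x i) volume := by
  intro x
  obtain ⟨U, hU, h⟩ := hG x
  exact ⟨U, hU, (EuclideanSpace.proj i : EuclideanSpace ℝ (Fin n) →L[ℝ] ℝ).integrable_comp h⟩

theorem IsWeakGradient.add {F G : EuclideanSpace ℝ (Fin n) → EuclideanSpace ℝ (Fin n)}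
    (hF : IsWeakGradient u F) (hG : IsWeakGradient v G) : IsWeakGradient (u + v) (F + G) := by
  refine ⟨hF.1.add hG.1, hF.2.add hG.2, fun φ hφ i => ?_⟩
  have h1 := hF.3 φ hφ i
  have h2 := hG.3 φ hφ i
  have e1 : ∀ w : EuclideanSpace ℝ (Fin n) → ℝ, LocallyIntegrable w volume →
      Integrable (fun x => w x * fderiv ℝ φ x (EuclideanSpace.single i 1)) volume := fun w hw =>
    integrable_mul_test hw (hφ.continuous_partial _) (hφ.hasCompactSupport_partial _)
  have e2 : ∀ w : EuclideanSpace ℝ (Fin n) → ℝ, LocallyIntegrable w volume →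
      Integrable (fun x => w x * φ x) volume := fun w hw =>
    integrable_mul_test hw hφ.continuous hφ.2
  simp only [Pi.add_apply, PiLp.add_apply, add_mul]
  rw [integral_add (e1 u hF.1) (e1 v hG.1),
    integral_add (e2 _ (locallyIntegrable_coord hF.2 i)) (e2 _ (locallyIntegrable_coord hG.2 i)),
    h1, h2]
  ring

theorem IsWeakGradient.smul {G : EuclideanSpace ℝ (Fin n) → EuclideanSpace ℝ (Fin n)} (c : ℝ)
    (hG : IsWeakGradient u G) : IsWeakGradient (c • u) (c • G) := by
  refine ⟨hG.1.smul c, hG.2.smul c, fun φ hφ i => ?_⟩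
  simp only [Pi.smul_apply, PiLp.smul_apply, smul_eq_mul, mul_assoc]
  rw [integral_const_mul, integral_const_mul, hG.3 φ hφ i]
  ring

theorem IsWeakGradient.const (c : ℝ) :
    IsWeakGradient (fun _ : EuclideanSpace ℝ (Fin n) => c) 0 := by
  refine ⟨continuous_const.locallyIntegrable, locallyIntegrable_zero, fun φ hφ i => ?_⟩
  have := integral_mul_fderiv_eq_neg_fderiv_mul_of_integrable (μ := volume)
    (f := fun _ : EuclideanSpace ℝ (Fin n) => c) (g := φ) (v := EuclideanSpace.single i 1)
    (by simp)
    (integrable_mul_test continuous_const.locallyIntegrable (hφ.continuous_partial _)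
      (hφ.hasCompactSupport_partial _))
    (integrable_mul_test continuous_const.locallyIntegrable hφ.continuous hφ.2)
    (fun x _ => by fun_prop) (fun x _ => (hφ.1.differentiable (by simp)) x)
  simpa using this

theorem gradSeminorm_add_le (hp : 1 ≤ p) :
    gradSeminorm n p (u + v) ≤ gradSeminorm n p u + gradSeminorm n p v := by
  unfold gradSeminorm
  refine ENNReal.le_of_forall_pos_le_add fun ε hε hfin => ?_
  have hε' : (ε : ℝ≥0∞) / 2 ≠ 0 := by simpa using hε.ne'
  obtain ⟨F, hF⟩ := iInf_lt_iff.1 (ENNReal.lt_add_right (ENNReal.add_lt_top.1 hfin).1.ne hε')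
  obtain ⟨hF, hF'⟩ := iInf_lt_iff.1 hF
  obtain ⟨G, hG⟩ := iInf_lt_iff.1 (ENNReal.lt_add_right (ENNReal.add_lt_top.1 hfin).2.ne hε')
  obtain ⟨hG, hG'⟩ := iInf_lt_iff.1 hG
  refine (iInf₂_le (F + G) (hF.add hG)).trans ?_
  refine (eLpNorm_add_le hF.2.aestronglyMeasurable hG.2.aestronglyMeasurable
    (by simpa using hp)).trans ?_
  refine (add_le_add hF'.le hG'.le).trans (le_of_eq ?_)
  rw [add_add_add_comm, ENNReal.add_halves]

theorem gradSeminorm_smul_le (c : ℝ) :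
    gradSeminorm n p (c • u) ≤ ‖c‖ₑ * gradSeminorm n p u := by
  unfold gradSeminorm
  rcases eq_or_ne c 0 with rfl | hc
  · refine (iInf₂_le (0 : EuclideanSpace ℝ (Fin n) → EuclideanSpace ℝ (Fin n)) ?_).trans ?_
    · have := IsWeakGradient.const (n := n) 0
      rw [zero_smul]
      exact this
    · simp
  · rw [ENNReal.mul_iInf_of_ne (by simpa using hc) (by simp)]
    refine le_iInf fun G => ?_
    rw [ENNReal.mul_iInf_of_ne (by simpa using hc) (by simp)]
    refine le_iInf fun hG => ?_
    refine (iInf₂_le (c • G) (hG.smul c)).trans ?_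
    rw [eLpNorm_const_smul]

theorem gagliardoIntegral_rpow (hp : 0 < p) (u : EuclideanSpace ℝ (Fin n) → ℝ) :
    gagliardoIntegral n s p u =
      ∫⁻ z : EuclideanSpace ℝ (Fin n) × EuclideanSpace ℝ (Fin n),
        (‖u z.1 - u z.2‖ₑ * ((‖z.1 - z.2‖ₑ ^ ((n : ℝ) + s * p))⁻¹) ^ (1 / p)) ^ p := by
  unfold gagliardoIntegral
  refine lintegral_congr fun z => ?_
  rw [ENNReal.mul_rpow_of_nonneg _ _ hp.le, ← ENNReal.rpow_mul, one_div, inv_mul_cancel₀ hp.ne',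
    ENNReal.rpow_one, div_eq_mul_inv]

theorem gagliardo_add_le (hp : 1 ≤ p) (hu : Continuous u) (hv : Continuous v) :
    gagliardo n s p (u + v) ≤ gagliardo n s p u + gagliardo n s p v := by
  have hp0 : 0 < p := by linarith
  unfold gagliardo
  split_ifs with hs
  · exact gradSeminorm_add_le hp
  · have hp1 : 0 ≤ 1 / p := by positivity
    simp only [ENNReal.mul_rpow_of_nonneg _ _ hp1, ← mul_add]
    gcongr
    simp only [gagliardoIntegral_rpow hp0]
    have hm : ∀ w : EuclideanSpace ℝ (Fin n) → ℝ, Continuous w →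
        AEMeasurable (fun z : EuclideanSpace ℝ (Fin n) × EuclideanSpace ℝ (Fin n) =>
          ‖w z.1 - w z.2‖ₑ * ((‖z.1 - z.2‖ₑ ^ ((n : ℝ) + s * p))⁻¹) ^ (1 / p)) volume := by
      intro w hw
      refine Measurable.aemeasurable (Measurable.mul ?_ ?_)
      · exact (Continuous.measurable (by fun_prop)).enorm
      · exact (((Continuous.measurable (by fun_prop)).enorm.pow_const _).inv).pow_const _
    refine le_trans ?_ (ENNReal.lintegral_Lp_add_le (hm u hu) (hm v hv) hp)
    refine ENNReal.rpow_le_rpow (lintegral_mono fun z => ?_) hp1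
    refine ENNReal.rpow_le_rpow ?_ hp0.le
    simp only [Pi.add_apply, ← add_mul]
    gcongr
    rw [add_sub_add_comm]
    exact enorm_add_le _ _

theorem gagliardo_smul_le (hp : 0 < p) (c : ℝ) :
    gagliardo n s p (c • u) ≤ ‖c‖ₑ * gagliardo n s p u := by
  unfold gagliardo
  split_ifs with hs
  · exact gradSeminorm_smul_le c
  · have hp1 : 0 ≤ 1 / p := by positivity
    have : gagliardoIntegral n s p (c • u) = ‖c‖ₑ ^ p * gagliardoIntegral n s p u := by
      unfold gagliardoIntegral
      rw [← lintegral_const_mul' _ _ (ENNReal.rpow_ne_top_of_nonneg hp.le (by simp))]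
      refine lintegral_congr fun z => ?_
      simp only [Pi.smul_apply, ← smul_sub, enorm_smul]
      rw [ENNReal.mul_rpow_of_nonneg _ _ hp.le, mul_div_assoc]
    rw [this, mul_left_comm, ENNReal.mul_rpow_of_nonneg _ _ hp1, ← ENNReal.rpow_mul, mul_one_div,
      div_self hp.ne', ENNReal.rpow_one]

theorem gagliardo_const (hp : 0 < p) (c : ℝ) :
    gagliardo n s p (fun _ => c) = 0 := by
  unfold gagliardo
  split_ifs with hs
  · refine le_antisymm ((iInf₂_le _ (IsWeakGradient.const c)).trans ?_) bot_le
    simp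
  · simp [gagliardoIntegral, hp]

theorem IsTest.gradSeminorm_lt_top (hu : IsTest u) : gradSeminorm n p u < ⊤ := by
  have hc : Continuous (gradient u) :=
    (InnerProductSpace.toDual ℝ (EuclideanSpace ℝ (Fin n))).symm.continuous.comp
      (hu.1.continuous_fderiv (by simp))
  have hs : HasCompactSupport (gradient u) :=
    (hu.2.fderiv ℝ).comp_left (g := (InnerProductSpace.toDual ℝ (EuclideanSpace ℝ (Fin n))).symm)
      (map_zero _)
  have hcoord : ∀ x (i : Fin n), gradient u x i = fderiv ℝ u x (EuclideanSpace.single i 1) := by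
    intro x i
    have : inner ℝ (gradient u x) (EuclideanSpace.single i (1 : ℝ))
        = fderiv ℝ u x (EuclideanSpace.single i 1) := by
      simp [gradient]
    rw [← this, EuclideanSpace.inner_single_right]
    simp
  refine lt_of_le_of_lt (iInf₂_le (gradient u) ⟨hu.continuous.locallyIntegrable,
    hc.locallyIntegrable, fun φ hφ i => ?_⟩) (hc.memLp_of_hasCompactSupport hs).2
  simp only [hcoord]
  exact integral_mul_fderiv_eq_neg_fderiv_mul_of_integrable
    (integrable_mul_test (hu.continuous_partial _).locallyIntegrable hφ.continuous hφ.2)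
    (integrable_mul_test hu.continuous.locallyIntegrable (hφ.continuous_partial _)
      (hφ.hasCompactSupport_partial _))
    (integrable_mul_test hu.continuous.locallyIntegrable hφ.continuous hφ.2)
    (fun x _ => hu.1.differentiable (by simp) x) (fun x _ => hφ.1.differentiable (by simp) x)

/-- The radial kernel `min(|h|, 1)^p / |h|^(n + s p)` is integrable when `0 < s < 1`. -/
theorem integrable_kernel (h : Exponents n s p) (hs1 : s < 1) :
    Integrable (fun x : EuclideanSpace ℝ (Fin n) => min ‖x‖ 1 ^ p / ‖x‖ ^ ((n : ℝ) + s * p))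
      volume := by
  have hp0 : 0 < p := by linarith [h.one_le_p]
  have : Nonempty (Fin n) := ⟨⟨0, h.one_le_n⟩⟩
  have hn : (((n - 1 : ℕ) : ℝ)) = (n : ℝ) - 1 := by
    rw [Nat.cast_sub h.one_le_n]; simp
  rw [integrable_fun_norm_addHaar (μ := volume)
    (f := fun r : ℝ => min r 1 ^ p / r ^ ((n : ℝ) + s * p))]
  simp only [finrank_euclideanSpace, Fintype.card_fin, smul_eq_mul]
  rw [← Set.Ioc_union_Ioi_eq_Ioi (zero_le_one (α := ℝ))]
  refine IntegrableOn.union ?_ ?_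
  · have h1 : IntegrableOn (fun r : ℝ => r ^ (p * (1 - s) - 1)) (Set.Ioc 0 1) := by
      rw [← intervalIntegrable_iff_integrableOn_Ioc_of_le zero_le_one]
      apply intervalIntegral.intervalIntegrable_rpow'
      have : 0 < p * (1 - s) := mul_pos hp0 (by linarith)
      linarith
    refine h1.congr_fun (fun r hr => ?_) measurableSet_Ioc
    have hr0 : 0 < r := hr.1
    simp only
    rw [min_eq_left hr.2, ← Real.rpow_natCast, hn, ← Real.rpow_sub hr0, ← Real.rpow_add hr0]
    congr 1
    ring
  · have h1 : IntegrableOn (fun r : ℝ => r ^ (-1 - s * p)) (Set.Ioi 1) := by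
      apply integrableOn_Ioi_rpow_of_lt _ one_pos
      have : 0 < s * p := mul_pos h.s_pos hp0
      linarith
    refine h1.congr_fun (fun r hr => ?_) measurableSet_Ioi
    have hr1 : 1 < r := hr
    have hr0 : 0 < r := by linarith
    simp only
    rw [min_eq_right hr1.le, ← Real.rpow_natCast, hn, Real.one_rpow, one_div,
      ← Real.rpow_neg hr0.le, ← Real.rpow_add hr0]
    congr 1
    ring

theorem IsTest.gagliardoIntegral_lt_top (h : Exponents n s p) (hs1 : s < 1) (hu : IsTest u) :
    gagliardoIntegral n s p u < ⊤ := by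
  have hp0 : 0 < p := by linarith [h.one_le_p]
  have : Nonempty (Fin n) := ⟨⟨0, h.one_le_n⟩⟩
  obtain ⟨L, hL⟩ := (hu.1.of_le (m := 1) (by simp)).lipschitzWith_of_hasCompactSupport hu.2 (by simp)
  obtain ⟨M, hM⟩ := hu.2.exists_bound_of_continuous hu.continuous
  set C : ℝ := max L (2 * M) with hC
  have hC0 : 0 ≤ C := le_max_of_le_left L.2
  have hbound : ∀ x y, ‖u x - u y‖ ≤ C * min ‖x - y‖ 1 := by
    intro x y
    rw [mul_min_of_nonneg _ _ hC0, mul_one]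
    refine le_min ?_ ?_
    · refine (hL.norm_sub_le x y).trans ?_
      gcongr
      exact le_max_left _ _
    · refine (norm_sub_le _ _).trans (le_trans ?_ (le_max_right _ _))
      linarith [hM x, hM y]
  set k : EuclideanSpace ℝ (Fin n) → ℝ≥0∞ := fun x =>
    ENNReal.ofReal (C ^ p * (min ‖x‖ 1 ^ p / ‖x‖ ^ ((n : ℝ) + s * p))) with hk
  have hkm : Measurable k := by
    refine ENNReal.measurable_ofReal.comp (Measurable.const_mul (Measurable.div ?_ ?_) _)
    · exact (measurable_norm.min measurable_const).pow_const _
    · exact measurable_norm.pow_const _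
  have hkint : ∫⁻ x, k x < ⊤ := ((integrable_kernel h hs1).const_mul _).lintegral_lt_top
  set K := tsupport u with hK
  have hKm : MeasurableSet K := (isClosed_tsupport u).measurableSet
  have hKfin : volume K < ⊤ := hu.2.isCompact.measure_lt_top
  have hexp : 0 < (n : ℝ) + s * p := by
    have := mul_pos h.s_pos hp0
    positivity
  have hpt : ∀ x y, ‖u x - u y‖ₑ ^ p / ‖x - y‖ₑ ^ ((n : ℝ) + s * p) ≤
      K.indicator 1 x * k (x - y) + K.indicator 1 y * k (x - y) := by
    intro x y
    have key : ‖u x - u y‖ₑ ^ p / ‖x - y‖ₑ ^ ((n : ℝ) + s * p) ≤ k (x - y) := by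
      rcases eq_or_ne x y with rfl | hxy
      · simp [hp0]
      have hpos : 0 < ‖x - y‖ := norm_pos_iff.2 (sub_ne_zero.2 hxy)
      rw [← ofReal_norm, ← ofReal_norm, ENNReal.ofReal_rpow_of_nonneg (norm_nonneg _) hp0.le,
        ENNReal.ofReal_rpow_of_pos hpos, ← ENNReal.ofReal_div_of_pos (by positivity)]
      refine ENNReal.ofReal_le_ofReal ?_
      rw [← mul_div_assoc, ← Real.mul_rpow hC0 (by positivity)]
      gcongr
      exact hbound x y
    by_cases hx : x ∈ K
    · rw [Set.indicator_of_mem hx]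
      exact key.trans (by simp)
    · by_cases hy : y ∈ K
      · rw [Set.indicator_of_mem hy]
        exact key.trans (by simp)
      · have h1 : u x = 0 := image_eq_zero_of_notMem_tsupport hx
        have h2 : u y = 0 := image_eq_zero_of_notMem_tsupport hy
        simp [h1, h2, hp0]
  have hind : Measurable (K.indicator (1 : EuclideanSpace ℝ (Fin n) → ℝ≥0∞)) :=
    measurable_one.indicator hKm
  have hI : ∫⁻ x, K.indicator (1 : EuclideanSpace ℝ (Fin n) → ℝ≥0∞) x = volume K :=
    lintegral_indicator_one hKm
  calc gagliardoIntegral n s p u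
      ≤ ∫⁻ z : EuclideanSpace ℝ (Fin n) × EuclideanSpace ℝ (Fin n),
          (K.indicator 1 z.1 * k (z.1 - z.2) + K.indicator 1 z.2 * k (z.1 - z.2)) :=
        lintegral_mono fun z => hpt z.1 z.2
    _ = (∫⁻ z : EuclideanSpace ℝ (Fin n) × EuclideanSpace ℝ (Fin n),
          K.indicator 1 z.1 * k (z.1 - z.2)) +
        ∫⁻ z : EuclideanSpace ℝ (Fin n) × EuclideanSpace ℝ (Fin n),
          K.indicator 1 z.2 * k (z.1 - z.2) := by
        rw [lintegral_add_left]
        fun_prop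
    _ = volume K * (∫⁻ x, k x) + volume K * (∫⁻ x, k x) := by
        congr 1
        · rw [Measure.volume_eq_prod, lintegral_prod _ (by fun_prop)]
          simp only
          have e : ∀ x, ∫⁻ y, K.indicator 1 x * k (x - y) = K.indicator 1 x * ∫⁻ y, k y := by
            intro x
            rw [lintegral_const_mul _ (by fun_prop), lintegral_sub_left_eq_self k]
          rw [lintegral_congr e, lintegral_mul_const _ hind, hI]
        · rw [Measure.volume_eq_prod, lintegral_prod_symm _ (by fun_prop)]
          simp only
          have e : ∀ y, ∫⁻ x, K.indicator 1 y * k (x - y) = K.indicator 1 y * ∫⁻ x, k x := by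
            intro y
            rw [lintegral_const_mul _ (by fun_prop), lintegral_sub_right_eq_self k]
          rw [lintegral_congr e, lintegral_mul_const _ hind, hI]
    _ < ⊤ := by
        have := ENNReal.mul_lt_top hKfin hkint
        exact ENNReal.add_lt_top.2 ⟨this, this⟩

/-- Test functions have finite seminorm. -/
theorem IsTest.gagliardo_lt_top (h : Exponents n s p) (hu : IsTest u) :
    gagliardo n s p u < ⊤ := by
  unfold gagliardo
  split_ifs with hs
  · exact hu.gradSeminorm_lt_top
  · have hp0 : 0 < p := by linarith [h.one_le_p]
    exact ENNReal.rpow_lt_top_of_nonneg (by positivity) (ENNReal.mul_lt_top ENNReal.ofReal_lt_top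
      (hu.gagliardoIntegral_lt_top h (lt_of_le_of_ne h.s_le_one hs))).ne

end Aux

/-! ### Turning the extended seminorm into a norm structure on a space of continuous functions -/

section Seminorm

variable {n : ℕ} {s p : ℝ}

/-- The real-valued seminorm `u ↦ [u]_{W^{s,p}}` on a vector space of continuous functions on which
it is finite. -/
def toSeminorm (h : Exponents n s p) (S : Submodule ℝ (EuclideanSpace ℝ (Fin n) → ℝ))
    (hc : ∀ u ∈ S, Continuous u) (hf : ∀ u ∈ S, gagliardo n s p u < ⊤) : Seminorm ℝ S :=
  Seminorm.ofSMulLE (fun u => (gagliardo n s p (u : EuclideanSpace ℝ (Fin n) → ℝ)).toReal)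
    (by
      have := gagliardo_const (n := n) (s := s) (p := p) (by linarith [h.one_le_p]) 0
      have e : ((0 : S) : EuclideanSpace ℝ (Fin n) → ℝ) = fun _ => 0 := rfl
      simp only [e, this, ENNReal.toReal_zero])
    (fun u v => by
      rw [← ENNReal.toReal_add (hf u u.2).ne (hf v v.2).ne]
      exact ENNReal.toReal_mono (ENNReal.add_lt_top.2 ⟨hf u u.2, hf v v.2⟩).ne
        (gagliardo_add_le h.one_le_p (hc u u.2) (hc v v.2)))
    (fun c u => by
      have := ENNReal.toReal_mono (ENNReal.mul_lt_top (by simp) (hf u u.2)).ne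
        (gagliardo_smul_le (n := n) (s := s) (p := p) (u := u) (by linarith [h.one_le_p]) c)
      rw [ENNReal.toReal_mul, toReal_enorm] at this
      exact this)

end Seminorm

/-! ### The completion `D^{s,p}(ℝⁿ)` -/

/-- The vector space `C_c^∞(ℝⁿ)`. -/
def testSubmodule (n : ℕ) : Submodule ℝ (EuclideanSpace ℝ (Fin n) → ℝ) where
  carrier := {φ | IsTest φ}
  add_mem' := IsTest.add
  zero_mem' := IsTest.zero
  smul_mem' c _ hu := hu.smul c

/-- `C_c^∞(ℝⁿ)` endowed with `[·]_{W^{s,p}(ℝⁿ)}`. -/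
def TestSpace (n : ℕ) (s p : ℝ) (_ : Exponents n s p) : Type := testSubmodule n

variable {n : ℕ} {s p : ℝ}

instance (h : Exponents n s p) : AddCommGroup (TestSpace n s p h) :=
  inferInstanceAs (AddCommGroup (testSubmodule n))

instance (h : Exponents n s p) : Module ℝ (TestSpace n s p h) :=
  inferInstanceAs (Module ℝ (testSubmodule n))

instance (h : Exponents n s p) : CoeFun (TestSpace n s p h)
    (fun _ => EuclideanSpace ℝ (Fin n) → ℝ) :=
  ⟨fun φ => φ.1⟩

/-- The seminorm `[·]_{W^{s,p}(ℝⁿ)}` on `C_c^∞(ℝⁿ)`. -/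
def TestSpace.seminorm (h : Exponents n s p) : Seminorm ℝ (TestSpace n s p h) :=
  toSeminorm h (testSubmodule n) (fun _ hu => hu.continuous) (fun _ hu => hu.gagliardo_lt_top h)

instance (h : Exponents n s p) : SeminormedAddCommGroup (TestSpace n s p h) :=
  (TestSpace.seminorm h).toAddGroupSeminorm.toSeminormedAddCommGroup

instance (h : Exponents n s p) : NormedSpace ℝ (TestSpace n s p h) where
  norm_smul_le c u := (map_smul_eq_mul (TestSpace.seminorm h) c u).le

theorem TestSpace.norm_def (h : Exponents n s p) (φ : TestSpace n s p h) :
    ‖φ‖ = (gagliardo n s p φ).toReal := rfl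

/-- The homogeneous Sobolev–Slobodeckij space `D^{s,p}(ℝⁿ)`: the completion of `C_c^∞(ℝⁿ)` with
respect to `[·]_{W^{s,p}(ℝⁿ)}` (Cauchy sequences up to null sequences, with the limit norm). -/
abbrev D (n : ℕ) (s p : ℝ) (h : Exponents n s p) : Type :=
  UniformSpace.Completion (TestSpace n s p h)

/-! ### The space of Hölder functions with finite seminorm modulo constants -/

theorem holderExponent_pos (h : Exponents n s p) (hsp : (n : ℝ) < s * p) : 0 < s - n / p := by
  have hp0 : 0 < p := by linarith [h.one_le_p]
  rw [sub_pos, div_lt_iff₀ hp0]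
  exact hsp

/-- The vector space of all `u ∈ C^{0,α}(ℝⁿ)`, `α = s - n / p > 0` (so that `toNNReal` is the
number itself), with `[u]_{W^{s,p}(ℝⁿ)} < ∞`. -/
def holderSubmodule (h : Exponents n s p) (hsp : (n : ℝ) < s * p) :
    Submodule ℝ (EuclideanSpace ℝ (Fin n) → ℝ) where
  carrier := {u | MemHolder (s - n / p).toNNReal u ∧ gagliardo n s p u < ⊤}
  add_mem' {u v} hu hv := by
    have hα := Real.toNNReal_pos.2 (holderExponent_pos h hsp)
    have hcu : Continuous u := hu.1.choose_spec.continuous hα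
    have hcv : Continuous v := hv.1.choose_spec.continuous hα
    exact ⟨hu.1.add hv.1, (gagliardo_add_le h.one_le_p hcu hcv).trans_lt
      (ENNReal.add_lt_top.2 ⟨hu.2, hv.2⟩)⟩
  zero_mem' := by
    refine ⟨memHolder_zero, ?_⟩
    have := gagliardo_const (n := n) (s := s) (p := p) (by linarith [h.one_le_p]) 0
    exact this.trans_lt (by simp)
  smul_mem' c u hu := ⟨hu.1.smul, (gagliardo_smul_le (by linarith [h.one_le_p]) c).trans_lt
    (ENNReal.mul_lt_top (by simp) hu.2)⟩

/-- The constant functions inside `{u ∈ C^{0,α}(ℝⁿ) : [u]_{W^{s,p}(ℝⁿ)} < ∞}`. -/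
def constSubmodule (h : Exponents n s p) (hsp : (n : ℝ) < s * p) :
    Submodule ℝ (holderSubmodule h hsp) where
  carrier := {u | ∃ c : ℝ, ∀ x, u.1 x = c}
  add_mem' := by
    rintro u v ⟨c, hc⟩ ⟨d, hd⟩
    exact ⟨c + d, fun x => by simp [hc, hd]⟩
  zero_mem' := ⟨0, fun _ => rfl⟩
  smul_mem' := by
    rintro a u ⟨c, hc⟩
    exact ⟨a * c, fun x => by simp [hc]⟩

/-- The quotient space `{u ∈ C^{0,α}(ℝⁿ) : [u]_{W^{s,p}(ℝⁿ)} < ∞} / ∼`, where `u ∼ v` means that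
`u - v` is constant. -/
def W (n : ℕ) (s p : ℝ) (h : Exponents n s p) (hsp : (n : ℝ) < s * p) : Type :=
  holderSubmodule h hsp ⧸ constSubmodule h hsp

instance (h : Exponents n s p) (hsp : (n : ℝ) < s * p) : AddCommGroup (W n s p h hsp) :=
  inferInstanceAs (AddCommGroup (holderSubmodule h hsp ⧸ constSubmodule h hsp))

instance (h : Exponents n s p) (hsp : (n : ℝ) < s * p) : Module ℝ (W n s p h hsp) :=
  inferInstanceAs (Module ℝ (holderSubmodule h hsp ⧸ constSubmodule h hsp))

/-- The class `{u}_C` of a function `u`, as a linear map. -/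
def W.mk (h : Exponents n s p) (hsp : (n : ℝ) < s * p) : holderSubmodule h hsp →ₗ[ℝ] W n s p h hsp :=
  (constSubmodule h hsp).mkQ

theorem W.mk_eq_mk_iff (h : Exponents n s p) (hsp : (n : ℝ) < s * p)
    (u v : holderSubmodule h hsp) :
    W.mk h hsp u = W.mk h hsp v ↔ ∃ c : ℝ, ∀ x, u.1 x - v.1 x = c :=
  Submodule.Quotient.eq (constSubmodule h hsp)

theorem W.mk_surjective (h : Exponents n s p) (hsp : (n : ℝ) < s * p) :
    Function.Surjective (W.mk h hsp) :=
  (constSubmodule h hsp).mkQ_surjective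

/-- The seminorm `[·]_{W^{s,p}(ℝⁿ)}` on `{u ∈ C^{0,α}(ℝⁿ) : [u]_{W^{s,p}(ℝⁿ)} < ∞}`. -/
def holderSeminorm (h : Exponents n s p) (hsp : (n : ℝ) < s * p) :
    Seminorm ℝ (holderSubmodule h hsp) :=
  toSeminorm h (holderSubmodule h hsp)
    (fun _ hu => hu.1.choose_spec.continuous (Real.toNNReal_pos.2 (holderExponent_pos h hsp)))
    (fun _ hu => hu.2)

theorem holderSeminorm_eq_of_sub_mem (h : Exponents n s p) (hsp : (n : ℝ) < s * p)
    (u v : holderSubmodule h hsp) (huv : u - v ∈ constSubmodule h hsp) :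
    holderSeminorm h hsp u = holderSeminorm h hsp v := by
  obtain ⟨c, hc⟩ := huv
  have h0 : holderSeminorm h hsp (u - v) = 0 := by
    have e : (u - v).1 = fun _ => c := funext hc
    change (gagliardo n s p (u - v).1).toReal = 0
    rw [e, gagliardo_const (by linarith [h.one_le_p])]
    rfl
  have h1 := abs_sub_map_le_sub (holderSeminorm h hsp) u v
  rw [h0] at h1
  exact sub_eq_zero.1 (abs_nonpos_iff.1 h1)

/-- `‖{u}_C‖ = [u]_{W^{s,p}(ℝⁿ)}` on the quotient. -/
def W.seminorm (h : Exponents n s p) (hsp : (n : ℝ) < s * p) : Seminorm ℝ (W n s p h hsp) :=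
  Seminorm.ofSMulLE
    (Quotient.lift (holderSeminorm h hsp) fun u v huv =>
      holderSeminorm_eq_of_sub_mem h hsp u v ((Submodule.quotientRel_def _).1 huv))
    (map_zero (holderSeminorm h hsp))
    (by
      intro a b
      obtain ⟨u, rfl⟩ := W.mk_surjective h hsp a
      obtain ⟨v, rfl⟩ := W.mk_surjective h hsp b
      exact map_add_le_add (holderSeminorm h hsp) u v)
    (by
      intro c a
      obtain ⟨u, rfl⟩ := W.mk_surjective h hsp a
      exact (map_smul_eq_mul (holderSeminorm h hsp) c u).le)

instance (h : Exponents n s p) (hsp : (n : ℝ) < s * p) :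
    SeminormedAddCommGroup (W n s p h hsp) :=
  (W.seminorm h hsp).toAddGroupSeminorm.toSeminormedAddCommGroup

instance (h : Exponents n s p) (hsp : (n : ℝ) < s * p) : NormedSpace ℝ (W n s p h hsp) where
  norm_smul_le c u := (map_smul_eq_mul (W.seminorm h hsp) c u).le

theorem W.norm_mk (h : Exponents n s p) (hsp : (n : ℝ) < s * p) (u : holderSubmodule h hsp) :
    ‖W.mk h hsp u‖ = (gagliardo n s p u.1).toReal := rfl

end HomogeneousSobolev

end

open HomogeneousSobolev

/-!
The theorem rests on three facts about continuous functions `u` on `ℝⁿ` with `[u] < ∞`, where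
`[·]` is the Gagliardo seminorm if `s < 1` and `‖∇u‖_p` if `s = 1`, and `α = s - n / p > 0`.

*Morrey's inequality.* If `u ∈ C^{0,α}`, then `|u x - u y| ≤ C [u] |x - y| ^ α` with `C`
independent of `u` (`exists_norm_sub_le`). For both kinds of seminorm, the integral of
`|u x - u y| ^ p` over `|x - y| < R` is at most `C R ^ (n + s p) [u] ^ p`
(`exists_setLIntegral_sub_le`). If `|u x - u y|` were much larger than `[u] |x - y| ^ α`, then so
would be `|u x' - u y'|` for all `x'`, `y'` in balls of radius `δ |x - y|` around `x` and `y`, up to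
a small multiple of the Hölder constant of `u`; that constant is finite a priori and is absorbed. So
the seminorm on the quotient by constants is a norm.

*Completeness* (`W.completeSpace`). A Cauchy sequence of classes, represented by functions vanishing
at `0`, converges locally uniformly by Morrey's inequality, to a function in `C^{0,α}`.
It converges in the seminorm as well, by Fatou's lemma if `s < 1`, and if `s = 1` because the weak
gradients converge in `L^p` and the weak gradient is a closed operator (`tendsto_gagliardo_sub`).

*Density of test functions* (`exists_isTest_gagliardo_sub_le_of_memHolder`). Let `v ∈ C^{0,α}` with
`v 0 = 0` and `[v] < ∞`, and let `η_R` be a cutoff function at scale `R`. The errors `v - v η_R` are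
bounded in the seminorm uniformly in `R`, because `n + α p = s p` makes the estimate scale invariant,
but they need not be small. However, their weak gradients (or their weighted difference quotients on
`ℝⁿ × ℝⁿ`) vanish on the ball of radius `R`. Along a sparse sequence of scales these are, up to small
tails, functions with disjoint supports, so that the arithmetic mean of `N` of them has `L^p` norm of
order `N ^ (1 / p - 1)`, which tends to `0` as `p > 1` (`exists_average_eLpNorm_le`). Thus `v` is
approximated by compactly supported functions, and these are approximated by mollification
(`exists_isTest_gagliardo_sub_le`).

Hence `φ ↦ {φ}_C` is a linear isometry with dense range from the test functions into a Banach space,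
and it extends to an isometric isomorphism from the completion.
-/

open scoped ENNReal NNReal Convolution Topology

noncomputable section

namespace HomogeneousSobolev

/-! ### Translations and averages of translates in `L^p` -/

section Translation

variable {X V : Type*} [NormedAddCommGroup X] [NormedSpace ℝ X] [FiniteDimensional ℝ X]
  [MeasurableSpace X] [BorelSpace X] {μ : Measure X} [μ.IsAddHaarMeasure]
  [NormedAddCommGroup V]

/-- Translations act continuously on `L^p`, `p < ∞`. -/
theorem tendsto_eLpNorm_translate_sub {F : X → V} {p : ℝ≥0∞} (hp1 : 1 ≤ p) (hp : p ≠ ⊤)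
    (hF : MemLp F p μ) :
    Filter.Tendsto (fun t : X => eLpNorm (fun x => F (x - t) - F x) p μ) (𝓝 0) (𝓝 0) := by
  have : Fact (1 ≤ p) := ⟨hp1⟩
  let g : C(X, C(X, X)) :=
    (ContinuousMap.mk (fun a : X × X => a.2 - a.1) (by fun_prop)).curry
  have hmp : ∀ t, MeasurePreserving (g t) μ μ := fun t => measurePreserving_sub_right μ t
  have hg : Filter.Tendsto (fun t => g t) (𝓝 0) (𝓝 (g 0)) := g.continuous.tendsto 0
  have h1 := Filter.Tendsto.compMeasurePreservingLp (E := V)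
    (tendsto_const_nhds (x := hF.toLp F) (f := 𝓝 (0 : X))) hg hmp (hmp 0) hp
  rw [tendsto_iff_edist_tendsto_0] at h1
  refine h1.congr fun t => ?_
  rw [Lp.edist_def]
  refine eLpNorm_congr_ae ?_
  have a1 := Lp.coeFn_compMeasurePreserving (hF.toLp F) (hmp t)
  have a2 := Lp.coeFn_compMeasurePreserving (hF.toLp F) (hmp 0)
  have a3 := (hmp t).quasiMeasurePreserving.ae_eq_comp hF.coeFn_toLp
  have a4 := (hmp 0).quasiMeasurePreserving.ae_eq_comp hF.coeFn_toLp
  filter_upwards [a1, a2, a3, a4] with x h1 h2 h3 h4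
  simp only [Pi.sub_apply, h1, h2, h3, h4]
  simp [g]

end Translation

/-- Jensen's inequality for the power `t ↦ t ^ p`, `1 ≤ p`. -/
theorem lintegral_rpow_le_lintegral_rpow {Y : Type*} [MeasurableSpace Y] {ν : Measure Y}
    [IsProbabilityMeasure ν] {p : ℝ} (hp : 1 ≤ p) {f : Y → ℝ≥0∞} (hf : AEMeasurable f ν) :
    (∫⁻ y, f y ∂ν) ^ p ≤ ∫⁻ y, f y ^ p ∂ν := by
  have hp0 : 0 < p := by linarith
  have h := eLpNorm_le_eLpNorm_of_exponent_le (μ := ν) (f := f) (p := 1) (q := ENNReal.ofReal p)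
    (by simpa using hp) hf.aestronglyMeasurable
  rw [eLpNorm_one_eq_lintegral_enorm, eLpNorm_eq_lintegral_rpow_enorm_toReal
    (by simpa using hp0) (by simp), ENNReal.toReal_ofReal hp0.le] at h
  simp only [enorm_eq_self] at h
  calc (∫⁻ y, f y ∂ν) ^ p ≤ ((∫⁻ y, f y ^ p ∂ν) ^ (1 / p)) ^ p :=
        ENNReal.rpow_le_rpow h hp0.le
    _ = _ := by rw [← ENNReal.rpow_mul, one_div, inv_mul_cancel₀ hp0.ne', ENNReal.rpow_one]

theorem eLpNorm_rpow {X V : Type*} [MeasurableSpace X] {μ : Measure X} [NormedAddCommGroup V]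
    {p : ℝ} (hp : 0 < p) (F : X → V) :
    eLpNorm F (ENNReal.ofReal p) μ ^ p = ∫⁻ x, ‖F x‖ₑ ^ p ∂μ := by
  rw [eLpNorm_eq_lintegral_rpow_enorm_toReal (by simpa using hp) (by simp),
    ENNReal.toReal_ofReal hp.le, ← ENNReal.rpow_mul, one_div, inv_mul_cancel₀ hp.ne',
    ENNReal.rpow_one]

theorem eLpNorm_le_iff_lintegral {X V : Type*} [MeasurableSpace X] {μ : Measure X}
    [NormedAddCommGroup V] {p : ℝ} (hp : 0 < p) {F : X → V} {a : ℝ≥0∞} :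
    eLpNorm F (ENNReal.ofReal p) μ ≤ a ↔ ∫⁻ x, ‖F x‖ₑ ^ p ∂μ ≤ a ^ p := by
  rw [← eLpNorm_rpow hp, ENNReal.rpow_le_rpow_iff hp]

/-- An average of translates of `F` is as close to `F` in `L^p` as the worst of the translates. It is
stated for a translation parameter in a space `Y` of its own, so that it also covers the translations
of `ℝⁿ × ℝⁿ` along its diagonal. -/
theorem eLpNorm_average_translate_sub_le {X Y V : Type*} [AddGroup X]
    [MeasurableSpace X] [MeasurableSub₂ X] {μ : Measure X} [SFinite μ]
    [MeasurableSpace Y] {ν : Measure Y} [IsProbabilityMeasure ν]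
    [NormedAddCommGroup V] [NormedSpace ℝ V] [CompleteSpace V] {p : ℝ} (hp : 1 ≤ p)
    {F : X → V} (hF : StronglyMeasurable F) {τ : Y → X} (hτ : Measurable τ)
    (hint : ∀ x, Integrable (fun y => F (x - τ y)) ν) {ε : ℝ≥0∞}
    (hε : ∀ᵐ y ∂ν, eLpNorm (fun x => F (x - τ y) - F x) (ENNReal.ofReal p) μ ≤ ε) :
    eLpNorm (fun x => (∫ y, F (x - τ y) ∂ν) - F x) (ENNReal.ofReal p) μ ≤ ε := by
  have hp0 : 0 < p := by linarith
  rw [eLpNorm_le_iff_lintegral hp0]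
  have hmeas : Measurable (fun z : X × Y => ‖F (z.1 - τ z.2) - F z.1‖ₑ) := by
    have h1 : StronglyMeasurable (fun z : X × Y => F (z.1 - τ z.2)) :=
      hF.comp_measurable (measurable_fst.sub (hτ.comp measurable_snd))
    exact (h1.sub (hF.comp_measurable measurable_fst)).enorm
  calc ∫⁻ x, ‖(∫ y, F (x - τ y) ∂ν) - F x‖ₑ ^ p ∂μ
      ≤ ∫⁻ x, ∫⁻ y, ‖F (x - τ y) - F x‖ₑ ^ p ∂ν ∂μ := by
        refine lintegral_mono fun x => ?_
        have e : (∫ y, F (x - τ y) ∂ν) - F x = ∫ y, (F (x - τ y) - F x) ∂ν := by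
          rw [integral_sub (hint x) (integrable_const _)]
          simp
        rw [e]
        refine (ENNReal.rpow_le_rpow (enorm_integral_le_lintegral_enorm _) hp0.le).trans ?_
        exact lintegral_rpow_le_lintegral_rpow hp
          (hmeas.comp measurable_prodMk_left).aemeasurable
    _ = ∫⁻ y, ∫⁻ x, ‖F (x - τ y) - F x‖ₑ ^ p ∂μ ∂ν :=
        lintegral_lintegral_swap (hmeas.pow_const p).aemeasurable
    _ ≤ ∫⁻ _, ε ^ p ∂ν := by
        refine lintegral_mono_ae ?_
        filter_upwards [hε] with y hy
        exact (eLpNorm_le_iff_lintegral hp0).1 hy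
    _ = ε ^ p := by simp

/-! ### Arithmetic means of sequences in `L^p` with receding supports -/

theorem exists_nat_rpow_mul_le {p : ℝ} (hp : 1 < p) {a b : ℝ≥0∞} (ha : a ≠ ⊤) (hb : b ≠ 0) :
    ∃ N : ℕ, 0 < N ∧ (N : ℝ≥0∞) ^ (1 - p) * a ≤ b := by
  have h1 : Filter.Tendsto (fun N : ℕ => ENNReal.ofReal ((N : ℝ) ^ (-(p - 1)))) Filter.atTop
      (𝓝 0) := by
    have := ENNReal.tendsto_ofReal ((tendsto_rpow_neg_atTop (y := p - 1) (by linarith)).comp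
      tendsto_natCast_atTop_atTop)
    simpa using this
  have h2 := ENNReal.Tendsto.mul_const (b := a) h1 (Or.inr ha)
  rw [zero_mul] at h2
  have h3 := h2.eventually (gt_mem_nhds (pos_iff_ne_zero.2 hb))
  obtain ⟨N, hN, hN'⟩ := (h3.and (Filter.eventually_gt_atTop 0)).exists
  refine ⟨N, hN', le_trans (le_of_eq ?_) hN.le⟩
  rw [← ENNReal.ofReal_rpow_of_pos (by exact_mod_cast hN'), ENNReal.ofReal_natCast, neg_sub]

section Averages

variable {X V : Type*} [MeasurableSpace X] {μ : Measure X} [NormedAddCommGroup V]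

theorem exists_eLpNorm_indicator_compl_le {p : ℝ} (hp : 0 < p) {f : X → V}
    (hf : MemLp f (ENNReal.ofReal p) μ) {S : ℕ → Set X} (hSm : ∀ k, MeasurableSet (S k))
    (hS : Monotone S) (hSu : ⋃ k, S k = Set.univ) {δ : ℝ≥0∞} (hδ : δ ≠ 0) (j : ℕ) :
    ∃ m, j < m ∧ eLpNorm ((S m)ᶜ.indicator f) (ENNReal.ofReal p) μ ≤ δ := by
  set ν := μ.withDensity fun x => ‖f x‖ₑ ^ p
  have hν : ν Set.univ ≠ ⊤ := by
    rw [withDensity_apply _ MeasurableSet.univ, Measure.restrict_univ, ← eLpNorm_rpow hp]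
    exact ENNReal.rpow_ne_top_of_nonneg hp.le hf.2.ne
  have h := tendsto_measure_iInter_atTop (μ := ν) (s := fun k => (S k)ᶜ)
    (fun k => (hSm k).compl.nullMeasurableSet) (fun a b hab => Set.compl_subset_compl.2 (hS hab))
    ⟨0, ne_top_of_le_ne_top hν (measure_mono (Set.subset_univ _))⟩
  rw [← Set.compl_iUnion, hSu, Set.compl_univ, measure_empty] at h
  have hδ' : (0 : ℝ≥0∞) < δ ^ p := by
    rw [pos_iff_ne_zero, Ne, ENNReal.rpow_eq_zero_iff]
    rintro (h | h)
    · exact hδ h.1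
    · linarith [h.2]
  obtain ⟨m, hm, hm'⟩ := ((h.eventually (gt_mem_nhds hδ')).and (Filter.eventually_gt_atTop j)).exists
  refine ⟨m, hm', ?_⟩
  rw [eLpNorm_indicator_eq_eLpNorm_restrict (hSm m).compl, eLpNorm_le_iff_lintegral hp]
  simp only [Function.comp_apply, ν] at hm
  rw [withDensity_apply _ (hSm m).compl] at hm
  exact hm.le

theorem lintegral_enorm_sum_indicator_rpow_le {p : ℝ} (hp : 0 < p) {f : ℕ → X → V} {M : ℝ≥0∞}
    (hf : ∀ k, AEStronglyMeasurable (f k) μ) (hM : ∀ k, eLpNorm (f k) (ENNReal.ofReal p) μ ≤ M)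
    {A : ℕ → Set X} (hAm : ∀ k, MeasurableSet (A k)) (hA : Pairwise (Function.onFun Disjoint A))
    (N : ℕ) :
    ∫⁻ x, ‖∑ i ∈ Finset.range N, (A i).indicator (f i) x‖ₑ ^ p ∂μ ≤ N * M ^ p := by
  have hpt : ∀ x, ‖∑ i ∈ Finset.range N, (A i).indicator (f i) x‖ₑ ^ p ≤
      ∑ i ∈ Finset.range N, ‖(A i).indicator (f i) x‖ₑ ^ p := by
    intro x
    by_cases hx : ∃ i ∈ Finset.range N, x ∈ A i
    · obtain ⟨i, hi, hxi⟩ := hx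
      rw [Finset.sum_eq_single_of_mem i hi]
      · exact Finset.single_le_sum (f := fun i => ‖(A i).indicator (f i) x‖ₑ ^ p)
          (fun _ _ => bot_le) hi
      · intro j _ hj
        exact Set.indicator_of_notMem (fun hxj => (hA hj).le_bot ⟨hxj, hxi⟩) _
    · push Not at hx
      rw [Finset.sum_eq_zero fun i hi => Set.indicator_of_notMem (hx i hi) _]
      simp [hp]
  calc _ ≤ ∫⁻ x, ∑ i ∈ Finset.range N, ‖(A i).indicator (f i) x‖ₑ ^ p ∂μ :=
        lintegral_mono hpt
    _ = ∑ i ∈ Finset.range N, ∫⁻ x, ‖(A i).indicator (f i) x‖ₑ ^ p ∂μ :=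
        lintegral_finsetSum' _ fun i _ => ((hf i).indicator (hAm i)).enorm.pow_const p
    _ ≤ ∑ i ∈ Finset.range N, M ^ p := by
        refine Finset.sum_le_sum fun i _ => ?_
        rw [← eLpNorm_le_iff_lintegral hp]
        exact (eLpNorm_indicator_le _).trans (hM i)
    _ = N * M ^ p := by simp

/-- A bounded sequence in `L^p`, `p > 1`, whose members vanish on larger and larger sets exhausting
the space has arithmetic means (along a sparse subsequence) of arbitrarily small norm: up to small
tails the members have disjoint supports, so that the norm of a sum of `N` of them is of the order
`N ^ (1 / p)`, which is `o(N)`. -/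
theorem exists_average_eLpNorm_le [NormedSpace ℝ V] {p : ℝ} (hp : 1 < p) {f : ℕ → X → V}
    (hf : ∀ k, AEStronglyMeasurable (f k) μ) {M : ℝ≥0∞} (hMt : M ≠ ⊤)
    (hM : ∀ k, eLpNorm (f k) (ENNReal.ofReal p) μ ≤ M)
    {S : ℕ → Set X} (hSm : ∀ k, MeasurableSet (S k)) (hS : Monotone S)
    (hSu : ⋃ k, S k = Set.univ) (hfS : ∀ k, ∀ x ∈ S k, f k x = 0) {ε : ℝ≥0∞} (hε : ε ≠ 0) :
    ∃ N : ℕ, 0 < N ∧ ∃ k : ℕ → ℕ,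
      eLpNorm (fun x => (N : ℝ)⁻¹ • ∑ i ∈ Finset.range N, f (k i) x) (ENNReal.ofReal p) μ ≤ ε := by
  have hp0 : 0 < p := by linarith
  have hε2 : ε / 2 ≠ 0 := by simpa using hε
  choose next hlt hnext using fun j : ℕ => exists_eLpNorm_indicator_compl_le hp0
    (⟨hf j, (hM j).trans_lt hMt.lt_top⟩ : MemLp (f j) (ENNReal.ofReal p) μ) hSm hS hSu hε2 j
  -- outside `S (k (i + 1))` the norm of `f (k i)` is at most `ε / 2`
  set k : ℕ → ℕ := fun i => next^[i] 0 with hk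
  have hk1 : ∀ i, k (i + 1) = next (k i) := fun i => Function.iterate_succ_apply' next i 0
  have hkm : StrictMono k := strictMono_nat_of_lt_succ fun i => by rw [hk1]; exact hlt _
  obtain ⟨N, hN, hNle⟩ := exists_nat_rpow_mul_le hp (a := M ^ p) (b := (ε / 2) ^ p)
    (ENNReal.rpow_ne_top_of_nonneg hp0.le hMt) (by
      rw [Ne, ENNReal.rpow_eq_zero_iff]
      rintro (h | h)
      · exact hε2 h.1
      · linarith [h.2])
  refine ⟨N, hN, k, ?_⟩
  set A : ℕ → Set X := fun i => S (k (i + 1)) \ S (k i) with hAdef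
  have hAm : ∀ i, MeasurableSet (A i) := fun i => (hSm _).diff (hSm _)
  have hA : Pairwise (Function.onFun Disjoint A) := by
    have key : ∀ i j, i < j → Disjoint (A i) (A j) := fun i j hij =>
      Set.disjoint_left.2 fun x hx hx' => hx'.2 (hS (hkm.monotone hij) hx.1)
    intro i j hij
    rcases lt_or_gt_of_ne hij with h | h
    · exact key i j h
    · exact (key j i h).symm
  have hNt : (N : ℝ≥0∞) ≠ ⊤ := by simp
  have hN0 : (N : ℝ≥0∞) ≠ 0 := by simpa using hN.ne'
  have hNe : ‖((N : ℝ)⁻¹)‖ₑ = (N : ℝ≥0∞)⁻¹ := by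
    rw [enorm_inv (by positivity)]
    simp
  -- `f (k i)` lives outside `S (k i)`, so it is the sum of a part on `A i` and of a small tail
  have hdec : (fun x => (N : ℝ)⁻¹ • ∑ i ∈ Finset.range N, f (k i) x) =
      ((N : ℝ)⁻¹ • fun x => ∑ i ∈ Finset.range N, (A i).indicator (f (k i)) x) +
      ((N : ℝ)⁻¹ • ∑ i ∈ Finset.range N, (S (next (k i)))ᶜ.indicator (f (k i))) := by
    ext x
    simp only [Pi.add_apply, Pi.smul_apply, Finset.sum_apply, ← smul_add, ← Finset.sum_add_distrib]
    congr 1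
    refine Finset.sum_congr rfl fun i _ => ?_
    by_cases h1 : x ∈ S (k i)
    · have h2 : x ∈ S (next (k i)) := hS (hlt _).le h1
      simp [hfS _ _ h1, h2, hAdef, h1]
    · by_cases h2 : x ∈ S (next (k i))
      · simp [hAdef, hk1, h1, h2]
      · simp [hAdef, hk1, h1, h2]
  have hmk : ∀ i, AEStronglyMeasurable ((A i).indicator (f (k i))) μ :=
    fun i => (hf _).indicator (hAm i)
  have hmk' : ∀ i, AEStronglyMeasurable ((S (next (k i)))ᶜ.indicator (f (k i))) μ :=
    fun i => (hf _).indicator (hSm _).compl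
  have hp1 : 1 ≤ ENNReal.ofReal p := by simpa using hp.le
  rw [hdec, ← ENNReal.add_halves ε]
  refine (eLpNorm_add_le ?_ ?_ hp1).trans (add_le_add ?_ ?_)
  · exact (Finset.aestronglyMeasurable_fun_sum _ fun i _ => hmk i).const_smul _
  · exact (Finset.aestronglyMeasurable_sum _ fun i _ => hmk' i).const_smul _
  · rw [eLpNorm_const_smul, hNe, ← ENNReal.rpow_le_rpow_iff hp0,
      ENNReal.mul_rpow_of_nonneg _ _ hp0.le, eLpNorm_rpow hp0]
    refine le_trans ?_ hNle
    calc _ ≤ (N : ℝ≥0∞)⁻¹ ^ p * (N * M ^ p) := by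
          gcongr
          exact lintegral_enorm_sum_indicator_rpow_le hp0 (fun i => hf (k i)) (fun i => hM (k i))
            hAm hA N
      _ = (N : ℝ≥0∞) ^ (1 - p) * M ^ p := by
          rw [← mul_assoc, sub_eq_neg_add, ENNReal.rpow_add _ _ hN0 hNt, ENNReal.rpow_one,
            ENNReal.rpow_neg, ENNReal.inv_rpow]
  · rw [eLpNorm_const_smul, hNe]
    calc _ ≤ (N : ℝ≥0∞)⁻¹ * ∑ i ∈ Finset.range N, ε / 2 := by
          gcongr
          refine (eLpNorm_sum_le (fun i _ => hmk' i) hp1).trans (Finset.sum_le_sum fun i _ => ?_)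
          exact hnext (k i)
      _ = ε / 2 := by
          rw [Finset.sum_const, Finset.card_range, nsmul_eq_mul, ← mul_assoc,
            ENNReal.inv_mul_cancel hN0 hNt, one_mul]

end Averages

/-! ### Weak gradients -/

section WeakGradient

variable {n : ℕ} {p : ℝ} {u : EuclideanSpace ℝ (Fin n) → ℝ}
  {G H : EuclideanSpace ℝ (Fin n) → EuclideanSpace ℝ (Fin n)}

theorem IsWeakGradient.congr (hG : IsWeakGradient u G) (h : G =ᵐ[volume] H) :
    IsWeakGradient u H := by
  refine ⟨hG.1, (locallyIntegrable_congr h).1 hG.2, fun φ hφ i => ?_⟩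
  rw [hG.3 φ hφ i]
  congr 1
  refine integral_congr_ae ?_
  filter_upwards [h] with x hx
  rw [hx]

theorem IsWeakGradient.ae_eq (hG : IsWeakGradient u G) (hH : IsWeakGradient u H) :
    G =ᵐ[volume] H := by
  have hi : ∀ i : Fin n, ∀ᵐ x, G x i = H x i := by
    intro i
    refine ae_eq_of_integral_contDiff_smul_eq (locallyIntegrable_coord hG.2 i)
      (locallyIntegrable_coord hH.2 i) fun φ hφ hc => ?_
    have h1 := hG.3 φ ⟨hφ, hc⟩ i
    rw [hH.3 φ ⟨hφ, hc⟩ i, neg_inj] at h1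
    simp only [smul_eq_mul, mul_comm (φ _)]
    exact h1.symm
  filter_upwards [ae_all_iff.2 hi] with x hx
  exact PiLp.ext hx

theorem gradSeminorm_eq (hG : IsWeakGradient u G) :
    gradSeminorm n p u = eLpNorm G (ENNReal.ofReal p) volume := by
  refine le_antisymm (iInf₂_le G hG) (le_iInf₂ fun H hH => ?_)
  rw [eLpNorm_congr_ae (hG.ae_eq hH)]

/-- A representative that is everywhere strongly measurable is convenient for Tonelli's theorem. -/
theorem exists_isWeakGradient (h : gradSeminorm n p u < ⊤) :
    ∃ G, IsWeakGradient u G ∧ StronglyMeasurable G ∧ MemLp G (ENNReal.ofReal p) volume := by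
  obtain ⟨G, hG⟩ := iInf_lt_iff.1 h
  obtain ⟨hG, hG'⟩ := iInf_lt_iff.1 hG
  have hm := hG.2.aestronglyMeasurable
  exact ⟨hm.mk G, hG.congr hm.ae_eq_mk, hm.stronglyMeasurable_mk,
    (memLp_congr_ae hm.ae_eq_mk).1 ⟨hm, hG'⟩⟩

theorem fderiv_single_of_hasGradientAt {x g : EuclideanSpace ℝ (Fin n)} (h : HasGradientAt u g x)
    (i : Fin n) : fderiv ℝ u x (EuclideanSpace.single i 1) = g i := by
  rw [h.hasFDerivAt.fderiv, InnerProductSpace.toDual_apply_apply,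
    EuclideanSpace.inner_single_right]
  simp

theorem isWeakGradient_of_hasGradientAt (h : ∀ x, HasGradientAt u (G x) x) (hG : Continuous G) :
    IsWeakGradient u G := by
  have hd : ∀ x, DifferentiableAt ℝ u x := fun x => (h x).differentiableAt
  have hc : Continuous u := continuous_iff_continuousAt.2 fun x => (hd x).continuousAt
  refine ⟨hc.locallyIntegrable, hG.locallyIntegrable, fun φ hφ i => ?_⟩
  have hGi : Continuous fun x => G x i := by fun_prop
  have e : ∀ x, fderiv ℝ u x (EuclideanSpace.single i 1) = G x i :=
    fun x => fderiv_single_of_hasGradientAt (h x) i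
  have := integral_mul_fderiv_eq_neg_fderiv_mul_of_integrable (μ := volume)
    (f := u) (g := φ) (v := EuclideanSpace.single i 1)
    (by simp only [e]; exact integrable_mul_test hGi.locallyIntegrable hφ.continuous hφ.2)
    (integrable_mul_test hc.locallyIntegrable (hφ.continuous_partial _)
      (hφ.hasCompactSupport_partial _))
    (integrable_mul_test hc.locallyIntegrable hφ.continuous hφ.2)
    (fun x _ => hd x) (fun x _ => (hφ.1.differentiable (by simp)) x)
  simpa only [e] using this

/-- Product rule for a weakly differentiable function and a smooth function. -/
theorem IsWeakGradient.mul_smooth (hG : IsWeakGradient u G) {η : EuclideanSpace ℝ (Fin n) → ℝ}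
    (hη : ContDiff ℝ ((⊤ : ℕ∞) : WithTop ℕ∞) η) :
    IsWeakGradient (fun x => u x * η x) (fun x => η x • G x + u x • gradient η x) := by
  have hgc : Continuous (gradient η) :=
    (InnerProductSpace.toDual ℝ (EuclideanSpace ℝ (Fin n))).symm.continuous.comp
      (hη.continuous_fderiv (by simp))
  have hcl : IsLocallyClosed (Set.univ : Set (EuclideanSpace ℝ (Fin n))) :=
    isClosed_univ.isLocallyClosed
  have hη' : ContinuousOn η Set.univ := hη.continuous.continuousOn
  have h1 : LocallyIntegrable (fun x => u x * η x) volume := by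
    rw [← locallyIntegrableOn_univ]
    exact (hG.1.locallyIntegrableOn Set.univ).mul_continuousOn hη' hcl
  have h2 : LocallyIntegrable (fun x => η x • G x) volume := by
    rw [← locallyIntegrableOn_univ]
    exact (hG.2.locallyIntegrableOn Set.univ).continuousOn_smul hcl hη'
  have h3 : LocallyIntegrable (fun x => u x • gradient η x) volume := by
    rw [← locallyIntegrableOn_univ]
    exact (hG.1.locallyIntegrableOn Set.univ).smul_continuousOn hcl hgc.continuousOn
  refine ⟨h1, h2.add h3, fun φ hφ i => ?_⟩
  have hdη : Differentiable ℝ η := hη.differentiable (by simp)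
  have hdφ : Differentiable ℝ φ := hφ.1.differentiable (by simp)
  have hgi : ∀ x, gradient η x i = fderiv ℝ η x (EuclideanSpace.single i 1) :=
    fun x => (fderiv_single_of_hasGradientAt (hdη x).hasGradientAt i).symm
  have htest : IsTest (fun x => η x * φ x) := ⟨hη.mul hφ.1, hφ.2.mul_left⟩
  have key := hG.3 _ htest i
  have hder : ∀ x, fderiv ℝ (fun x => η x * φ x) x (EuclideanSpace.single i 1) =
      η x * fderiv ℝ φ x (EuclideanSpace.single i 1) + φ x * gradient η x i := by
    intro x
    rw [fderiv_fun_mul (hdη x) (hdφ x), hgi]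
    simp
  simp only [hder, mul_add] at key
  have i1 : Integrable (fun x => u x * η x * fderiv ℝ φ x (EuclideanSpace.single i 1)) volume :=
    integrable_mul_test h1 (hφ.continuous_partial _) (hφ.hasCompactSupport_partial _)
  have i2 : Integrable (fun x => (u x • gradient η x) i * φ x) volume :=
    integrable_mul_test (locallyIntegrable_coord h3 i) hφ.continuous hφ.2
  have i3 : Integrable (fun x => (η x • G x) i * φ x) volume :=
    integrable_mul_test (locallyIntegrable_coord h2 i) hφ.continuous hφ.2
  rw [integral_add (by simpa only [mul_assoc] using i1)
    (by simpa [mul_assoc, mul_comm, mul_left_comm] using i2)] at key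
  simp only [PiLp.add_apply, add_mul]
  rw [integral_add i3 i2]
  simp only [PiLp.smul_apply, smul_eq_mul]
  have e1 : ∫ x, u x * (φ x * gradient η x i) = ∫ x, u x * gradient η x i * φ x := by
    congr 1; ext x; ring
  have e2 : ∫ x, G x i * (η x * φ x) = ∫ x, η x * G x i * φ x := by
    congr 1; ext x; ring
  simp only [mul_assoc] at e1 e2 key ⊢
  rw [e1, e2] at key
  linarith

end WeakGradient

/-! ### Mollification -/

section Mollification

variable {n : ℕ}

variable (φ : ContDiffBump (0 : EuclideanSpace ℝ (Fin n)))

/-- The probability measure whose density is the normalized bump function `φ`. -/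
def bumpMeasure : Measure (EuclideanSpace ℝ (Fin n)) :=
  volume.withDensity fun t => ENNReal.ofReal (φ.normed volume t)

theorem measurable_ofReal_normed :
    Measurable fun t => ENNReal.ofReal (φ.normed volume t) :=
  φ.continuous_normed.measurable.ennreal_ofReal

instance : IsProbabilityMeasure (bumpMeasure φ) := by
  refine ⟨?_⟩
  rw [bumpMeasure, withDensity_apply _ MeasurableSet.univ, Measure.restrict_univ,
    ← ofReal_integral_eq_lintegral_ofReal φ.integrable_normed
      (Filter.Eventually.of_forall φ.nonneg_normed), φ.integral_normed, ENNReal.ofReal_one]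

theorem ae_bumpMeasure_norm_lt : ∀ᵐ t ∂bumpMeasure φ, ‖t‖ < φ.rOut := by
  rw [bumpMeasure, ae_withDensity_iff (measurable_ofReal_normed φ)]
  refine Filter.Eventually.of_forall fun t ht => ?_
  have : t ∈ Function.support (φ.normed volume) := fun h0 => ht (by simp [h0])
  rw [φ.support_normed_eq] at this
  simpa using this

theorem integral_bumpMeasure {V : Type*} [NormedAddCommGroup V] [NormedSpace ℝ V]
    (g : EuclideanSpace ℝ (Fin n) → V) :
    ∫ t, g t ∂bumpMeasure φ = ∫ t, φ.normed volume t • g t := by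
  rw [bumpMeasure, integral_withDensity_eq_integral_toReal_smul (measurable_ofReal_normed φ)
    (by simp)]
  simp only [ENNReal.toReal_ofReal (φ.nonneg_normed _)]

theorem integrable_bumpMeasure {V : Type*} [NormedAddCommGroup V] [NormedSpace ℝ V]
    {g : EuclideanSpace ℝ (Fin n) → V} (hg : LocallyIntegrable g volume) :
    Integrable g (bumpMeasure φ) := by
  rw [bumpMeasure, integrable_withDensity_iff_integrable_smul' (measurable_ofReal_normed φ)
    (by simp)]
  simp only [ENNReal.toReal_ofReal (φ.nonneg_normed _)]
  exact hg.integrable_smul_left_of_hasCompactSupport φ.continuous_normed φ.hasCompactSupport_normed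

theorem locallyIntegrable_comp_sub_left {V : Type*} [NormedAddCommGroup V]
    {g : EuclideanSpace ℝ (Fin n) → V} (hg : LocallyIntegrable g volume)
    (x : EuclideanSpace ℝ (Fin n)) : LocallyIntegrable (fun t => g (x - t)) volume := by
  have := (locallyIntegrable_map_homeomorph (Homeomorph.subLeft x) (f := g) (μ := volume)).1
  rw [show Measure.map (Homeomorph.subLeft x) volume = volume from
    (Measure.measurePreserving_sub_left volume x).map_eq] at this
  exact this hg

/-- The mollification of `u` by the normalized bump function `φ`. -/
def mollify {V : Type*} [NormedAddCommGroup V] [NormedSpace ℝ V]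
    (u : EuclideanSpace ℝ (Fin n) → V) (x : EuclideanSpace ℝ (Fin n)) : V :=
  ∫ t, u (x - t) ∂bumpMeasure φ

theorem mollify_eq_convolution {V : Type*} [NormedAddCommGroup V] [NormedSpace ℝ V]
    (u : EuclideanSpace ℝ (Fin n) → V) :
    mollify φ u = φ.normed volume ⋆[ContinuousLinearMap.lsmul ℝ ℝ, volume] u := by
  ext x
  rw [mollify, integral_bumpMeasure]
  rfl

theorem continuous_mollify {V : Type*} [NormedAddCommGroup V] [NormedSpace ℝ V]
    {u : EuclideanSpace ℝ (Fin n) → V} (hu : LocallyIntegrable u volume) :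
    Continuous (mollify φ u) := by
  rw [mollify_eq_convolution]
  exact φ.hasCompactSupport_normed.continuous_convolution_left _ φ.continuous_normed hu

theorem isTest_mollify {u : EuclideanSpace ℝ (Fin n) → ℝ} (hu : Continuous u)
    (hc : HasCompactSupport u) : IsTest (mollify φ u) := by
  rw [mollify_eq_convolution]
  exact ⟨φ.hasCompactSupport_normed.contDiff_convolution_left _ φ.contDiff_normed
    hu.locallyIntegrable, φ.hasCompactSupport_normed.convolution _ hc⟩

/-- The mollification of a weakly differentiable function is classically differentiable, and its
gradient is the mollification of the weak gradient. -/
theorem IsWeakGradient.hasGradientAt_mollify {u : EuclideanSpace ℝ (Fin n) → ℝ}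
    {G : EuclideanSpace ℝ (Fin n) → EuclideanSpace ℝ (Fin n)} (hG : IsWeakGradient u G)
    (x : EuclideanSpace ℝ (Fin n)) : HasGradientAt (mollify φ u) (mollify φ G x) x := by
  have h := φ.hasCompactSupport_normed.hasFDerivAt_convolution_left (μ := volume)
    (ContinuousLinearMap.lsmul ℝ ℝ) (φ.contDiff_normed (μ := volume) (n := 1)) hG.1 x
  rw [hasGradientAt_iff_hasFDerivAt, mollify_eq_convolution]
  suffices e : InnerProductSpace.toDual ℝ _ (mollify φ G x) =
      (fderiv ℝ (φ.normed volume) ⋆[(ContinuousLinearMap.lsmul ℝ ℝ).precompL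
        (EuclideanSpace ℝ (Fin n)), volume] u) x by
    rw [e]
    exact h
  have hex := ((φ.hasCompactSupport_normed (μ := volume)).fderiv ℝ).convolutionExists_left
    ((ContinuousLinearMap.lsmul ℝ ℝ).precompL (EuclideanSpace ℝ (Fin n)))
    ((φ.contDiff_normed (μ := volume) (n := 1)).continuous_fderiv (by simp)) hG.1 x
  have hdρ : Differentiable ℝ (φ.normed volume) :=
    (φ.contDiff_normed (n := 1)).differentiable (by simp)
  have hcoe : ∀ L L' : EuclideanSpace ℝ (Fin n) →L[ℝ] ℝ,
      (∀ i, L (EuclideanSpace.single i 1) = L' (EuclideanSpace.single i 1)) → L = L' := by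
    intro L L' hL
    refine ContinuousLinearMap.coe_injective
      ((EuclideanSpace.basisFun (Fin n) ℝ).toBasis.ext fun i => ?_)
    simpa using hL i
  refine hcoe _ _ fun i => ?_
  have htest : IsTest fun y => φ.normed volume (x - y) :=
    ⟨φ.contDiff_normed.comp (contDiff_const.sub contDiff_id),
      φ.hasCompactSupport_normed.comp_homeomorph (Homeomorph.subLeft x)⟩
  have hder : ∀ y, fderiv ℝ (fun y => φ.normed volume (x - y)) y (EuclideanSpace.single i 1) =
      -fderiv ℝ (φ.normed volume) (x - y) (EuclideanSpace.single i 1) := by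
    intro y
    have h1 : HasFDerivAt (fun y => φ.normed volume (x - y))
        ((fderiv ℝ (φ.normed volume) (x - y)).comp
          (-(ContinuousLinearMap.id ℝ (EuclideanSpace ℝ (Fin n))))) y :=
      (hdρ (x - y)).hasFDerivAt.comp y ((hasFDerivAt_id y).const_sub x)
    rw [h1.fderiv]
    simp
  have key := hG.3 _ htest i
  simp only [hder, mul_neg, integral_neg, neg_inj] at key
  have hr : ((fderiv ℝ (φ.normed volume) ⋆[(ContinuousLinearMap.lsmul ℝ ℝ).precompL
      (EuclideanSpace ℝ (Fin n)), volume] u) x) (EuclideanSpace.single i 1) =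
      ∫ t, fderiv ℝ (φ.normed volume) t (EuclideanSpace.single i 1) * u (x - t) := by
    rw [convolution, ContinuousLinearMap.integral_apply hex]
    simp
  have hl : InnerProductSpace.toDual ℝ _ (mollify φ G x) (EuclideanSpace.single i 1) =
      ∫ t, φ.normed volume t * G (x - t) i := by
    rw [InnerProductSpace.toDual_apply_apply, EuclideanSpace.inner_single_right]
    simp only [mollify, conj_trivial, one_mul]
    rw [integral_bumpMeasure]
    have hint : Integrable (fun t => φ.normed volume t • G (x - t)) volume :=
      (locallyIntegrable_comp_sub_left hG.2 x).integrable_smul_left_of_hasCompactSupport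
        φ.continuous_normed φ.hasCompactSupport_normed
    exact ((EuclideanSpace.proj i : EuclideanSpace ℝ (Fin n) →L[ℝ] ℝ).integral_comp_comm
      hint).symm
  rw [hl, hr]
  rw [← integral_sub_left_eq_self (fun t => φ.normed volume t * G (x - t) i) volume x,
    ← integral_sub_left_eq_self
      (fun t => fderiv ℝ (φ.normed volume) t (EuclideanSpace.single i 1) * u (x - t)) volume x]
  simp only [sub_sub_cancel]
  simp only [mul_comm (φ.normed volume _), mul_comm (fderiv ℝ (φ.normed volume) _ _)]
  exact key.symm

end Mollification

/-! ### Increments of functions with finite seminorm -/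

section Increments

variable {n : ℕ} {s p : ℝ} {u : EuclideanSpace ℝ (Fin n) → ℝ}
  {G : EuclideanSpace ℝ (Fin n) → EuclideanSpace ℝ (Fin n)}

theorem eLpNorm_mollify_le (hp : 1 ≤ p) (φ : ContDiffBump (0 : EuclideanSpace ℝ (Fin n)))
    (hG : StronglyMeasurable G) :
    eLpNorm (mollify φ G) (ENNReal.ofReal p) volume ≤ eLpNorm G (ENNReal.ofReal p) volume := by
  have hp0 : 0 < p := by linarith
  rw [eLpNorm_le_iff_lintegral hp0]
  have hmeas : Measurable (fun z : EuclideanSpace ℝ (Fin n) × EuclideanSpace ℝ (Fin n) =>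
      ‖G (z.1 - z.2)‖ₑ) := (hG.comp_measurable (measurable_fst.sub measurable_snd)).enorm
  calc ∫⁻ x, ‖mollify φ G x‖ₑ ^ p
      ≤ ∫⁻ x, ∫⁻ t, ‖G (x - t)‖ₑ ^ p ∂bumpMeasure φ := by
        refine lintegral_mono fun x => ?_
        refine (ENNReal.rpow_le_rpow (enorm_integral_le_lintegral_enorm _) hp0.le).trans ?_
        exact lintegral_rpow_le_lintegral_rpow hp (hmeas.comp measurable_prodMk_left).aemeasurable
    _ = ∫⁻ t, ∫⁻ x, ‖G (x - t)‖ₑ ^ p ∂volume ∂bumpMeasure φ :=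
        lintegral_lintegral_swap (hmeas.pow_const p).aemeasurable
    _ = ∫⁻ _, ∫⁻ x, ‖G x‖ₑ ^ p ∂volume ∂bumpMeasure φ :=
        lintegral_congr fun t => lintegral_sub_right_eq_self (fun x => ‖G x‖ₑ ^ p) t
    _ = eLpNorm G (ENNReal.ofReal p) volume ^ p := by
        rw [eLpNorm_rpow hp0]
        simp

/-- The increment `u (· + h) - u` is the integral of `⟪∇u, h⟫` along a segment of translates. -/
theorem lintegral_increment_le_of_hasGradientAt (hp : 1 ≤ p)
    (hu : ∀ x, HasGradientAt u (G x) x) (hG : Continuous G) (h : EuclideanSpace ℝ (Fin n)) :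
    ∫⁻ x, ‖u (x + h) - u x‖ₑ ^ p ≤ ‖h‖ₑ ^ p * ∫⁻ x, ‖G x‖ₑ ^ p := by
  have hp0 : 0 < p := by linarith
  set ν : Measure ℝ := volume.restrict (Set.Ioc 0 1)
  have : IsProbabilityMeasure ν := ⟨by simp [ν]⟩
  have hmeas : Measurable (fun z : EuclideanSpace ℝ (Fin n) × ℝ => ‖G (z.1 + z.2 • h)‖ₑ) :=
    (Continuous.measurable (by fun_prop)).enorm
  have hpt : ∀ x, ‖u (x + h) - u x‖ₑ ≤ ∫⁻ t, ‖h‖ₑ * ‖G (x + t • h)‖ₑ ∂ν := by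
    intro x
    have hd : ∀ t ∈ Set.uIcc (0 : ℝ) 1, HasDerivAt (fun t : ℝ => u (x + t • h))
        (inner ℝ (G (x + t • h)) h) t := by
      intro t _
      have h1 : HasDerivAt (fun t : ℝ => x + t • h) h t := by
        simpa using ((hasDerivAt_id t).smul_const h).const_add x
      exact ((hu (x + t • h)).hasFDerivAt.comp_hasDerivAt t h1).congr_deriv
        (InnerProductSpace.toDual_apply_apply ..)
    have hc : Continuous fun t : ℝ => (inner ℝ (G (x + t • h)) h : ℝ) := by fun_prop
    have h3 := intervalIntegral.integral_eq_sub_of_hasDerivAt hd (hc.intervalIntegrable 0 1)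
    simp only [one_smul, zero_smul, add_zero] at h3
    rw [← h3, intervalIntegral.integral_of_le zero_le_one]
    refine (enorm_integral_le_lintegral_enorm _).trans (lintegral_mono fun t => ?_)
    rw [mul_comm, ← ofReal_norm, ← ofReal_norm, ← ofReal_norm,
      ← ENNReal.ofReal_mul (norm_nonneg _)]
    exact ENNReal.ofReal_le_ofReal (norm_inner_le_norm _ _)
  calc ∫⁻ x, ‖u (x + h) - u x‖ₑ ^ p
      ≤ ∫⁻ x, ∫⁻ t, ‖h‖ₑ ^ p * ‖G (x + t • h)‖ₑ ^ p ∂ν := by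
        refine lintegral_mono fun x => ?_
        refine (ENNReal.rpow_le_rpow (hpt x) hp0.le).trans ?_
        simp only [← ENNReal.mul_rpow_of_nonneg _ _ hp0.le]
        exact lintegral_rpow_le_lintegral_rpow hp
          ((hmeas.comp measurable_prodMk_left).const_mul _).aemeasurable
    _ = ∫⁻ t, ∫⁻ x, ‖h‖ₑ ^ p * ‖G (x + t • h)‖ₑ ^ p ∂volume ∂ν :=
        lintegral_lintegral_swap ((hmeas.pow_const p).const_mul _).aemeasurable
    _ = ∫⁻ _, ‖h‖ₑ ^ p * ∫⁻ x, ‖G x‖ₑ ^ p ∂volume ∂ν := by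
        refine lintegral_congr fun t => ?_
        rw [lintegral_const_mul' _ _ (ENNReal.rpow_ne_top_of_nonneg hp0.le (by simp)),
          lintegral_add_right_eq_self (fun x => ‖G x‖ₑ ^ p) (t • h)]
    _ = _ := by simp

theorem exists_bump_seq (n : ℕ) : ∃ φ : ℕ → ContDiffBump (0 : EuclideanSpace ℝ (Fin n)),
    Filter.Tendsto (fun k => (φ k).rOut) Filter.atTop (𝓝 0) :=
  ⟨fun k => ⟨1 / ((k : ℝ) + 1) / 2, 1 / ((k : ℝ) + 1), by positivity,
    half_lt_self (by positivity)⟩, tendsto_one_div_add_atTop_nhds_zero_nat⟩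

/-- Mollification and Fatou's lemma transfer the increment estimate from smooth functions. -/
theorem IsWeakGradient.lintegral_increment_le (hp : 1 ≤ p) (hu : Continuous u)
    (hG : IsWeakGradient u G) (h : EuclideanSpace ℝ (Fin n)) :
    ∫⁻ x, ‖u (x + h) - u x‖ₑ ^ p ≤ ‖h‖ₑ ^ p * eLpNorm G (ENNReal.ofReal p) volume ^ p := by
  have hp0 : 0 < p := by linarith
  wlog hm : StronglyMeasurable G generalizing G
  · have hm := hG.2.aestronglyMeasurable
    rw [eLpNorm_congr_ae hm.ae_eq_mk]
    exact this (hG.congr hm.ae_eq_mk) hm.stronglyMeasurable_mk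
  obtain ⟨φ, hφ⟩ := exists_bump_seq n
  have hlim : ∀ x, Filter.Tendsto (fun k => ‖mollify (φ k) u (x + h) - mollify (φ k) u x‖ₑ ^ p)
      Filter.atTop (𝓝 (‖u (x + h) - u x‖ₑ ^ p)) := by
    intro x
    have h1 : ∀ y, Filter.Tendsto (fun k => mollify (φ k) u y) Filter.atTop (𝓝 (u y)) := by
      intro y
      simp only [mollify_eq_convolution]
      exact ContDiffBump.convolution_tendsto_right_of_continuous hφ hu y
    exact (ENNReal.continuous_rpow_const.tendsto _).comp ((h1 _).sub (h1 _)).enorm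
  have hcont : ∀ k, Continuous (mollify (φ k) u) := fun k =>
    continuous_mollify (φ k) hG.1
  calc ∫⁻ x, ‖u (x + h) - u x‖ₑ ^ p
      = ∫⁻ x, Filter.liminf
          (fun k => ‖mollify (φ k) u (x + h) - mollify (φ k) u x‖ₑ ^ p) Filter.atTop :=
        lintegral_congr fun x => (hlim x).liminf_eq.symm
    _ ≤ Filter.liminf
          (fun k => ∫⁻ x, ‖mollify (φ k) u (x + h) - mollify (φ k) u x‖ₑ ^ p) Filter.atTop := by
        refine lintegral_liminf_le fun k => ?_
        have := hcont k
        exact (Continuous.measurable (by fun_prop)).enorm.pow_const p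
    _ ≤ ‖h‖ₑ ^ p * eLpNorm G (ENNReal.ofReal p) volume ^ p := by
        refine Filter.liminf_le_of_le (by isBoundedDefault) fun b hb => ?_
        obtain ⟨k, hk⟩ := hb.exists
        refine hk.trans ((lintegral_increment_le_of_hasGradientAt hp
          (hG.hasGradientAt_mollify (φ k)) (continuous_mollify (φ k) hG.2) h).trans ?_)
        rw [← eLpNorm_rpow hp0]
        gcongr
        exact eLpNorm_mollify_le hp (φ k) hm

theorem measurableSet_norm_sub_lt (R : ℝ) : MeasurableSet
    {z : EuclideanSpace ℝ (Fin n) × EuclideanSpace ℝ (Fin n) | ‖z.1 - z.2‖ < R} :=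
  (isOpen_lt (by fun_prop) continuous_const).measurableSet

/-- The change of variables `x = y + h` in a double integral. -/
theorem lintegral_prod_eq_lintegral_increments
    {f : EuclideanSpace ℝ (Fin n) × EuclideanSpace ℝ (Fin n) → ℝ≥0∞} (hf : Measurable f) :
    ∫⁻ z, f z = ∫⁻ h, ∫⁻ y, f (y + h, y) := by
  have hm : Measurable fun z : EuclideanSpace ℝ (Fin n) × EuclideanSpace ℝ (Fin n) =>
      f (z.2 + z.1, z.2) := hf.comp ((measurable_snd.add measurable_fst).prodMk measurable_snd)
  rw [lintegral_lintegral_swap (f := fun h y => f (y + h, y)) hm.aemeasurable,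
    Measure.volume_eq_prod, lintegral_prod_symm _ hf.aemeasurable]
  exact lintegral_congr fun y => (lintegral_add_left_eq_self (fun x => f (x, y)) y).symm

theorem IsWeakGradient.setLIntegral_sub_le (hp : 1 ≤ p) (hu : Continuous u)
    (hG : IsWeakGradient u G) (R : ℝ) :
    ∫⁻ z in {z : EuclideanSpace ℝ (Fin n) × EuclideanSpace ℝ (Fin n) | ‖z.1 - z.2‖ < R},
      ‖u z.1 - u z.2‖ₑ ^ p ≤ volume (Metric.ball (0 : EuclideanSpace ℝ (Fin n)) R) *
        (ENNReal.ofReal R ^ p * eLpNorm G (ENNReal.ofReal p) volume ^ p) := by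
  have hp0 : 0 < p := by linarith
  have hm : Measurable fun z : EuclideanSpace ℝ (Fin n) × EuclideanSpace ℝ (Fin n) =>
      ‖u z.1 - u z.2‖ₑ ^ p := (Continuous.measurable (by fun_prop)).enorm.pow_const p
  rw [← lintegral_indicator (measurableSet_norm_sub_lt R),
    lintegral_prod_eq_lintegral_increments (hm.indicator (measurableSet_norm_sub_lt R)), mul_comm,
    ← setLIntegral_const, ← lintegral_indicator measurableSet_ball]
  refine lintegral_mono fun h => ?_
  by_cases hh : ‖h‖ < R
  · rw [Set.indicator_of_mem (mem_ball_zero_iff.2 hh)]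
    refine (lintegral_mono fun y => Set.indicator_le_self' (fun _ _ => bot_le) _).trans
      ((hG.lintegral_increment_le hp hu h).trans ?_)
    gcongr
    rw [← ofReal_norm]
    exact ENNReal.ofReal_le_ofReal hh.le
  · refine le_trans (le_of_eq ?_) bot_le
    refine (lintegral_congr fun y => Set.indicator_of_notMem ?_ _).trans lintegral_zero
    simpa using hh

/-- The increments of `u` at distance less than `R`, averaged in `L^p`, are controlled by the
seminorm of `u`. This is the only quantitative input of the Morrey-type estimate, and it has the
same form for the Gagliardo seminorms and for the gradient seminorm. -/
theorem exists_setLIntegral_sub_le (h : Exponents n s p) :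
    ∃ C : ℝ, 0 ≤ C ∧ ∀ u : EuclideanSpace ℝ (Fin n) → ℝ, Continuous u → ∀ R : ℝ, 0 < R →
      ∫⁻ z in {z : EuclideanSpace ℝ (Fin n) × EuclideanSpace ℝ (Fin n) | ‖z.1 - z.2‖ < R},
        ‖u z.1 - u z.2‖ₑ ^ p ≤
        ENNReal.ofReal (C * R ^ ((n : ℝ) + s * p)) * gagliardo n s p u ^ p := by
  have hp0 : 0 < p := by linarith [h.one_le_p]
  have : Nonempty (Fin n) := ⟨⟨0, h.one_le_n⟩⟩
  rcases eq_or_ne s 1 with rfl | hs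
  · refine ⟨volume.real (Metric.ball (0 : EuclideanSpace ℝ (Fin n)) 1), measureReal_nonneg,
      fun u hu R hR => ?_⟩
    simp only [gagliardo, if_true, one_mul]
    by_cases hfin : gradSeminorm n p u = ⊤
    · rw [hfin, ENNReal.top_rpow_of_pos hp0, ENNReal.mul_top]
      · exact le_top
      · rw [Ne, ENNReal.ofReal_eq_zero, not_le]
        have : 0 < volume.real (Metric.ball (0 : EuclideanSpace ℝ (Fin n)) 1) :=
          ENNReal.toReal_pos (Metric.measure_ball_pos _ _ one_pos).ne' measure_ball_lt_top.ne
        positivity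
    · obtain ⟨G, hG, -, -⟩ := exists_isWeakGradient (lt_top_iff_ne_top.2 hfin)
      rw [gradSeminorm_eq hG]
      refine (hG.setLIntegral_sub_le h.one_le_p hu R).trans (le_of_eq ?_)
      rw [Measure.addHaar_ball _ _ hR.le, finrank_euclideanSpace, Fintype.card_fin, ← mul_assoc]
      congr 1
      rw [ENNReal.ofReal_rpow_of_pos hR, ← ofReal_measureReal measure_ball_lt_top.ne,
        ← ENNReal.ofReal_mul (by positivity), ← ENNReal.ofReal_mul (by positivity),
        Real.rpow_add hR, Real.rpow_natCast]
      congr 1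
      ring
  · have hs1 : s < 1 := lt_of_le_of_ne h.s_le_one hs
    have hc : 0 < s * (1 - s) := mul_pos h.s_pos (by linarith)
    have hexp : 0 ≤ (n : ℝ) + s * p := by
      have := mul_pos h.s_pos hp0
      positivity
    refine ⟨(s * (1 - s))⁻¹, by positivity, fun u hu R hR => ?_⟩
    simp only [gagliardo, if_neg hs]
    rw [← ENNReal.rpow_mul, one_div, inv_mul_cancel₀ hp0.ne', ENNReal.rpow_one, ← mul_assoc,
      ← ENNReal.ofReal_mul (by positivity)]
    have e : (s * (1 - s))⁻¹ * R ^ ((n : ℝ) + s * p) * (s * (1 - s)) = R ^ ((n : ℝ) + s * p) := by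
      rw [mul_right_comm, inv_mul_cancel₀ hc.ne', one_mul]
    rw [e, ← ENNReal.ofReal_rpow_of_pos hR, gagliardoIntegral,
      ← lintegral_const_mul' _ _ (ENNReal.rpow_ne_top_of_nonneg hexp (by simp))]
    refine le_trans (setLIntegral_mono' (measurableSet_norm_sub_lt R) fun z hz => ?_)
      (setLIntegral_le_lintegral _ _)
    rcases eq_or_ne z.1 z.2 with hzz | hzz
    · simp [hzz, hp0]
    have hpos : 0 < ‖z.1 - z.2‖ₑ := by simpa [sub_eq_zero] using hzz
    have hle : ‖z.1 - z.2‖ₑ ≤ ENNReal.ofReal R := by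
      rw [← ofReal_norm]
      exact ENNReal.ofReal_le_ofReal (le_of_lt hz)
    rw [← mul_div_assoc, mul_comm, mul_div_assoc]
    refine le_mul_of_one_le_right bot_le ?_
    rw [ENNReal.le_div_iff_mul_le (Or.inl ?_) (Or.inl ?_), one_mul]
    · exact ENNReal.rpow_le_rpow hle hexp
    · rw [Ne, ENNReal.rpow_eq_zero_iff]
      rintro (h' | h')
      · exact hpos.ne' h'.1
      · linarith [h'.2]
    · exact ENNReal.rpow_ne_top_of_nonneg hexp (by simp)

end Increments

/-! ### The Morrey-type inequality -/

section Morrey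

variable {n : ℕ} {s p : ℝ} {u : EuclideanSpace ℝ (Fin n) → ℝ}

theorem holderWith_iff_norm {α : ℝ} (hα : 0 < α) {K : ℝ≥0} :
    HolderWith K α.toNNReal u ↔ ∀ x y, ‖u x - u y‖ ≤ K * ‖x - y‖ ^ α := by
  refine forall₂_congr fun x y => ?_
  rw [Real.coe_toNNReal _ hα.le, edist_dist, edist_dist,
    ENNReal.ofReal_rpow_of_nonneg dist_nonneg hα.le, ← ENNReal.ofReal_coe_nnreal,
    ← ENNReal.ofReal_mul K.coe_nonneg, ENNReal.ofReal_le_ofReal_iff (by positivity), dist_eq_norm,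
    dist_eq_norm]

theorem continuous_of_memHolder {α : ℝ} (hα : 0 < α) (hu : MemHolder α.toNNReal u) :
    Continuous u := hu.choose_spec.continuous (Real.toNNReal_pos.2 hα)

/-- Chebyshev's inequality on a product of two balls: if `u` differs by at least `m` between any
points of the two balls, then `m` is controlled by the integral of the increments of `u`. -/
theorem rpow_mul_volume_le {C : ℝ} (hp : 0 < p) (hn : 1 ≤ n) {g : ℝ} (hg : 0 ≤ g) (hC : 0 ≤ C)
    {e : ℝ} {x y : EuclideanSpace ℝ (Fin n)} {ρ R m : ℝ} (hρ : 0 ≤ ρ) (hR : ‖x - y‖ + 2 * ρ ≤ R)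
    (hR0 : 0 < R) (hm : 0 ≤ m)
    (hosc : ∀ x' ∈ Metric.ball x ρ, ∀ y' ∈ Metric.ball y ρ, m ≤ ‖u x' - u y'‖)
    (hinc : ∫⁻ z in {z : EuclideanSpace ℝ (Fin n) × EuclideanSpace ℝ (Fin n) | ‖z.1 - z.2‖ < R},
        ‖u z.1 - u z.2‖ₑ ^ p ≤ ENNReal.ofReal (C * R ^ e) * ENNReal.ofReal g ^ p) :
    m ^ p * (ρ ^ n * volume.real (Metric.ball (0 : EuclideanSpace ℝ (Fin n)) 1)) ^ 2 ≤
      C * R ^ e * g ^ p := by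
  have : Nonempty (Fin n) := ⟨⟨0, hn⟩⟩
  have hvol : ∀ z : EuclideanSpace ℝ (Fin n), volume (Metric.ball z ρ) =
      ENNReal.ofReal (ρ ^ n * volume.real (Metric.ball (0 : EuclideanSpace ℝ (Fin n)) 1)) := by
    intro z
    rw [Measure.addHaar_ball _ _ hρ, finrank_euclideanSpace, Fintype.card_fin,
      ENNReal.ofReal_mul (by positivity), ofReal_measureReal measure_ball_lt_top.ne]
  have hsub : Metric.ball x ρ ×ˢ Metric.ball y ρ ⊆
      {z : EuclideanSpace ℝ (Fin n) × EuclideanSpace ℝ (Fin n) | ‖z.1 - z.2‖ < R} := by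
    rintro ⟨x', y'⟩ ⟨hx, hy⟩
    have h1 : ‖x' - x‖ < ρ := by simpa [dist_eq_norm] using hx
    have h2 : ‖y' - y‖ < ρ := by simpa [dist_eq_norm] using hy
    have h3 : x' - y' = (x' - x) + (x - y) - (y' - y) := by abel
    change ‖x' - y'‖ < R
    rw [h3]
    have := norm_sub_le ((x' - x) + (x - y)) (y' - y)
    have := norm_add_le (x' - x) (x - y)
    linarith
  have key : ENNReal.ofReal m ^ p * (volume (Metric.ball x ρ) * volume (Metric.ball y ρ)) ≤
      ENNReal.ofReal (C * R ^ e) * ENNReal.ofReal g ^ p := by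
    refine le_trans ?_ ((lintegral_mono_set hsub).trans hinc)
    rw [← Measure.prod_prod, ← Measure.volume_eq_prod, ← setLIntegral_const]
    refine setLIntegral_mono' (measurableSet_ball.prod measurableSet_ball) fun z hz => ?_
    refine ENNReal.rpow_le_rpow ?_ hp.le
    rw [← ofReal_norm]
    exact ENNReal.ofReal_le_ofReal (hosc _ hz.1 _ hz.2)
  rw [hvol, hvol, ENNReal.ofReal_rpow_of_nonneg hm hp.le, ENNReal.ofReal_rpow_of_nonneg hg hp.le,
    ← ENNReal.ofReal_mul (by positivity), ← ENNReal.ofReal_mul (by positivity),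
    ← ENNReal.ofReal_mul (by positivity), ENNReal.ofReal_le_ofReal_iff (by positivity)] at key
  rw [sq]
  exact key

/-- Morrey-type inequality: on `C^{0,α}` functions the Hölder constant is controlled by the
seminorm. As the Hölder constant is finite to begin with, it can be absorbed: comparing the values
at `x` and `y` with those on balls of radius `δ ‖x - y‖` costs half of the Hölder constant when
`δ ^ α = 1 / 4`. -/
theorem exists_norm_sub_le (h : Exponents n s p) (hsp : (n : ℝ) < s * p) :
    ∃ C : ℝ, 0 ≤ C ∧ ∀ u : EuclideanSpace ℝ (Fin n) → ℝ, MemHolder (s - n / p).toNNReal u →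
      gagliardo n s p u < ⊤ → ∀ x y,
        ‖u x - u y‖ ≤ C * (gagliardo n s p u).toReal * ‖x - y‖ ^ (s - n / p) := by
  have hp0 : 0 < p := by linarith [h.one_le_p]
  have : Nonempty (Fin n) := ⟨⟨0, h.one_le_n⟩⟩
  set α : ℝ := s - n / p with hαdef
  have hα : 0 < α := holderExponent_pos h hsp
  obtain ⟨C, hC0, hC⟩ := exists_setLIntegral_sub_le h
  set ω : ℝ := volume.real (Metric.ball (0 : EuclideanSpace ℝ (Fin n)) 1)
  have hω : 0 < ω := ENNReal.toReal_pos (Metric.measure_ball_pos _ _ one_pos).ne'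
    measure_ball_lt_top.ne
  set δ : ℝ := (1 / 4) ^ (1 / α)
  have hδ0 : 0 < δ := by positivity
  have hδ1 : δ ≤ 1 := Real.rpow_le_one (by norm_num) (by norm_num) (by positivity)
  have hδα : δ ^ α = 1 / 4 := by
    rw [← Real.rpow_mul (by norm_num), one_div_mul_cancel hα.ne', Real.rpow_one]
  set e : ℝ := n + s * p
  set A : ℝ := C * 3 ^ e / (δ ^ n * ω) ^ 2
  set B : ℝ := A ^ (1 / p)
  have hA : 0 ≤ A := by positivity
  have hB : 0 ≤ B := by positivity
  refine ⟨2 * B, by positivity, fun u hu hfin => ?_⟩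
  set g := (gagliardo n s p u).toReal
  have hg : 0 ≤ g := ENNReal.toReal_nonneg
  set K := nnHolderNorm α.toNNReal u
  have hK : ∀ x y, ‖u x - u y‖ ≤ K * ‖x - y‖ ^ α := (holderWith_iff_norm hα).1 hu.holderWith
  have key : ∀ x y, ‖u x - u y‖ ≤ (K / 2 + B * g) * ‖x - y‖ ^ α := by
    intro x y
    rcases eq_or_ne x y with rfl | hxy
    · simp [hα.ne']
    set r := ‖x - y‖
    have hr : 0 < r := norm_pos_iff.2 (sub_ne_zero.2 hxy)
    set m := ‖u x - u y‖ - K / 2 * r ^ α with hm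
    suffices hmle : m ≤ B * g * r ^ α by
      rw [hm] at hmle
      linarith
    rcases le_or_gt m 0 with hm0 | hm0
    · exact hm0.trans (by positivity)
    have hball : ∀ z, ∀ z' ∈ Metric.ball z (δ * r), ‖u z' - u z‖ ≤ K / 4 * r ^ α := by
      intro z z' hz
      have h1 : ‖z' - z‖ ≤ δ * r := by
        have : ‖z' - z‖ < δ * r := by simpa [dist_eq_norm] using hz
        exact this.le
      calc ‖u z' - u z‖ ≤ K * ‖z' - z‖ ^ α := hK _ _
        _ ≤ K * (δ * r) ^ α := by gcongr
        _ = K / 4 * r ^ α := by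
          rw [Real.mul_rpow hδ0.le hr.le, hδα]
          ring
    have hosc : ∀ x' ∈ Metric.ball x (δ * r), ∀ y' ∈ Metric.ball y (δ * r),
        m ≤ ‖u x' - u y'‖ := by
      intro x' hx y' hy
      have h1 := hball x x' hx
      have h2 := hball y y' hy
      have h3 : u x - u y = (u x' - u y') - (u x' - u x) + (u y' - u y) := by ring
      have h4 : ‖u x - u y‖ ≤ ‖u x' - u y'‖ + ‖u x' - u x‖ + ‖u y' - u y‖ := by
        rw [h3]
        exact (norm_add_le _ _).trans (add_le_add_left (norm_sub_le _ _) _)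
      rw [hm]
      linarith
    have hmark := rpow_mul_volume_le (R := 3 * r) hp0 h.one_le_n hg hC0 (by positivity)
      (by nlinarith : ‖x - y‖ + 2 * (δ * r) ≤ 3 * r) (by positivity) hm0.le hosc
      (by
        have := hC u (continuous_of_memHolder hα hu) (3 * r) (by positivity)
        rwa [← ENNReal.ofReal_toReal hfin.ne] at this)
    have hexp : r ^ e = (r ^ n) ^ 2 * (r ^ α) ^ p := by
      rw [← Real.rpow_mul hr.le, ← pow_mul, ← Real.rpow_natCast, ← Real.rpow_add hr]
      congr 1
      simp only [e, hαdef]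
      push_cast
      field_simp
      ring
    have hle : m ^ p ≤ A * (g * r ^ α) ^ p := by
      rw [Real.mul_rpow (by norm_num) hr.le, hexp, mul_pow] at hmark
      rw [Real.mul_rpow hg (by positivity)]
      simp only [A]
      rw [div_mul_eq_mul_div, le_div_iff₀ (by positivity)]
      have hr2 : 0 < (r ^ n) ^ 2 := by positivity
      refine le_of_mul_le_mul_right ?_ hr2
      calc m ^ p * (δ ^ n * ω) ^ 2 * (r ^ n) ^ 2 = m ^ p * (((δ * r) ^ n) ^ 2 * ω ^ 2) := by ring
        _ ≤ C * (3 ^ e * ((r ^ n) ^ 2 * (r ^ α) ^ p)) * g ^ p := hmark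
        _ = C * 3 ^ e * (g ^ p * (r ^ α) ^ p) * (r ^ n) ^ 2 := by ring
    calc m = (m ^ p) ^ (1 / p) := by
          rw [← Real.rpow_mul hm0.le, mul_one_div_cancel hp0.ne', Real.rpow_one]
      _ ≤ (A * (g * r ^ α) ^ p) ^ (1 / p) := by gcongr
      _ = B * g * r ^ α := by
          rw [Real.mul_rpow hA (by positivity), ← Real.rpow_mul (by positivity),
            mul_one_div_cancel hp0.ne', Real.rpow_one, mul_assoc]
  have hKle : (K : ℝ) ≤ K / 2 + B * g := by
    have h1 : HolderWith (K / 2 + B.toNNReal * g.toNNReal) α.toNNReal u := by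
      rw [holderWith_iff_norm hα]
      simpa [Real.coe_toNNReal _ hB, Real.coe_toNNReal _ hg] using key
    have h2 := NNReal.coe_le_coe.2 h1.nnholderNorm_le
    simpa [Real.coe_toNNReal _ hB, Real.coe_toNNReal _ hg] using h2
  intro x y
  refine (hK x y).trans ?_
  gcongr
  linarith

end Morrey

/-! ### Completeness of the quotient space -/

section Completeness

variable {n : ℕ} {s p : ℝ}

/-- For `s < 1` the seminorm is lower semicontinuous under pointwise convergence. -/
theorem gagliardo_le_of_tendsto (hp : 0 < p) (hs : s ≠ 1)
    {w : ℕ → EuclideanSpace ℝ (Fin n) → ℝ} {u : EuclideanSpace ℝ (Fin n) → ℝ}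
    (hw : ∀ k, Continuous (w k)) (hlim : ∀ x, Filter.Tendsto (fun k => w k x) Filter.atTop (𝓝 (u x)))
    {a : ℝ≥0∞} (ha : ∀ᶠ k in Filter.atTop, gagliardo n s p (w k) ≤ a) :
    gagliardo n s p u ≤ a := by
  have hp1 : 0 < 1 / p := by positivity
  have hF : gagliardoIntegral n s p u ≤
      Filter.liminf (fun k => gagliardoIntegral n s p (w k)) Filter.atTop := by
    unfold gagliardoIntegral
    refine le_trans (lintegral_mono fun z => ?_) (lintegral_liminf_le fun k => ?_)
    · rcases eq_or_ne z.1 z.2 with hz | hz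
      · simp [hz, hp]
      refine le_of_eq (Filter.Tendsto.liminf_eq ?_).symm
      simp only [div_eq_mul_inv]
      refine ENNReal.Tendsto.mul_const
        ((ENNReal.continuous_rpow_const.tendsto _).comp ((hlim _).sub (hlim _)).enorm) (Or.inr ?_)
      rw [Ne, ENNReal.inv_eq_top, ENNReal.rpow_eq_zero_iff]
      rintro (h | h)
      · exact hz (sub_eq_zero.1 (by simpa using h.1))
      · simp at h
    · have := hw k
      exact ((Continuous.measurable (by fun_prop)).enorm.pow_const _).div
        ((Continuous.measurable (by fun_prop)).enorm.pow_const _)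
  unfold gagliardo at ha ⊢
  simp only [if_neg hs] at ha ⊢
  have e : ∀ I : ℝ≥0∞, (ENNReal.ofReal (s * (1 - s)) * I) ^ (1 / p) ≤ a ↔
      ENNReal.ofReal (s * (1 - s)) * I ≤ a ^ p := by
    intro I
    rw [one_div, ENNReal.rpow_inv_le_iff hp]
  simp only [e] at ha ⊢
  refine (mul_le_mul_right hF _).trans ?_
  obtain ⟨N, hN⟩ := Filter.eventually_atTop.1 ha
  by_cases hc : ENNReal.ofReal (s * (1 - s)) = 0
  · simp [hc]
  rw [mul_comm, ← ENNReal.le_div_iff_mul_le (Or.inl hc) (Or.inl ENNReal.ofReal_ne_top)]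
  refine Filter.liminf_le_of_le (by isBoundedDefault) fun b hb => ?_
  obtain ⟨k, hk, hk'⟩ := (hb.and ha).exists
  refine hk.trans ?_
  rwa [ENNReal.le_div_iff_mul_le (Or.inl hc) (Or.inl ENNReal.ofReal_ne_top), mul_comm]

/-- The weak gradient is a closed operator; on the functions themselves locally dominated pointwise
convergence suffices. -/
theorem IsWeakGradient.of_tendsto (hp : 1 ≤ p) {v : ℕ → EuclideanSpace ℝ (Fin n) → ℝ}
    {u b : EuclideanSpace ℝ (Fin n) → ℝ}
    {F : ℕ → EuclideanSpace ℝ (Fin n) → EuclideanSpace ℝ (Fin n)}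
    {G : EuclideanSpace ℝ (Fin n) → EuclideanSpace ℝ (Fin n)}
    (hF : ∀ k, IsWeakGradient (v k) (F k)) (hG : MemLp G (ENNReal.ofReal p) volume)
    (hFG : Filter.Tendsto (fun k => eLpNorm (F k - G) (ENNReal.ofReal p) volume) Filter.atTop (𝓝 0))
    (hvu : ∀ x, Filter.Tendsto (fun k => v k x) Filter.atTop (𝓝 (u x))) (hu : Continuous u)
    (hb : Continuous b) (hvb : ∀ k x, ‖v k x‖ ≤ b x) : IsWeakGradient u G := by
  have hp1 : 1 ≤ ENNReal.ofReal p := by simpa using hp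
  have hGl : LocallyIntegrable G volume := hG.locallyIntegrable hp1
  refine ⟨hu.locallyIntegrable, hGl, fun φ hφ i => ?_⟩
  have h1 : Filter.Tendsto
      (fun k => ∫ x, v k x * fderiv ℝ φ x (EuclideanSpace.single i 1)) Filter.atTop
      (𝓝 (∫ x, u x * fderiv ℝ φ x (EuclideanSpace.single i 1))) := by
    refine tendsto_integral_of_dominated_convergence
      (fun x => b x * ‖fderiv ℝ φ x (EuclideanSpace.single i 1)‖) (fun k => ?_) ?_ (fun k => ?_) ?_
    · exact (integrable_mul_test (hF k).1 (hφ.continuous_partial _)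
        (hφ.hasCompactSupport_partial _)).aestronglyMeasurable
    · exact integrable_mul_test hb.locallyIntegrable (hφ.continuous_partial _).norm
        (hφ.hasCompactSupport_partial _).norm
    · refine Filter.Eventually.of_forall fun x => ?_
      rw [norm_mul]
      gcongr
      exact hvb k x
    · exact Filter.Eventually.of_forall fun x => (hvu x).mul_const _
  have h2 : Filter.Tendsto (fun k => ∫ x, F k x i * φ x) Filter.atTop (𝓝 (∫ x, G x i * φ x)) := by
    have hint : ∀ H : EuclideanSpace ℝ (Fin n) → EuclideanSpace ℝ (Fin n),
        LocallyIntegrable H volume → Integrable (fun x => H x i * φ x) volume := fun H hH =>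
      integrable_mul_test (locallyIntegrable_coord hH i) hφ.continuous hφ.2
    refine tendsto_integral_of_L1 _ (hint G hGl).aestronglyMeasurable
      (Filter.Eventually.of_forall fun k => hint (F k) (hF k).2) ?_
    obtain ⟨M, hM⟩ := hφ.2.exists_bound_of_continuous hφ.continuous
    set K := tsupport φ
    have hKm : MeasurableSet K := (isClosed_tsupport φ).measurableSet
    have hKfin : volume K < ⊤ := hφ.2.isCompact.measure_lt_top
    have hbound : ∀ k, ∫⁻ x, ‖F k x i * φ x - G x i * φ x‖ₑ ≤
        eLpNorm (F k - G) (ENNReal.ofReal p) volume *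
          (volume K ^ (1 - 1 / p) * ENNReal.ofReal M) := by
      intro k
      have hm : AEStronglyMeasurable (F k - G) (volume.restrict K) :=
        ((hF k).2.aestronglyMeasurable.sub hG.1).restrict
      calc ∫⁻ x, ‖F k x i * φ x - G x i * φ x‖ₑ
          ≤ ∫⁻ x, K.indicator (fun x => ‖(F k - G) x‖ₑ * ENNReal.ofReal M) x := by
            refine lintegral_mono fun x => ?_
            by_cases hx : x ∈ K
            · rw [Set.indicator_of_mem hx, ← sub_mul, enorm_mul]
              gcongr
              · rw [← ofReal_norm, ← ofReal_norm]
                exact ENNReal.ofReal_le_ofReal (PiLp.norm_apply_le ((F k - G) x) i)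
              · rw [← ofReal_norm]
                exact ENNReal.ofReal_le_ofReal (hM x)
            · have : φ x = 0 := image_eq_zero_of_notMem_tsupport hx
              simp [this]
        _ = eLpNorm (F k - G) 1 (volume.restrict K) * ENNReal.ofReal M := by
            rw [lintegral_indicator hKm, lintegral_mul_const' _ _ ENNReal.ofReal_ne_top,
              eLpNorm_one_eq_lintegral_enorm]
        _ ≤ (eLpNorm (F k - G) (ENNReal.ofReal p) (volume.restrict K) *
              (volume.restrict K) Set.univ ^ (1 / (1 : ℝ≥0∞).toReal -
                1 / (ENNReal.ofReal p).toReal)) * ENNReal.ofReal M := by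
            gcongr
            exact eLpNorm_le_eLpNorm_mul_rpow_measure_univ hp1 hm
        _ ≤ _ := by
            rw [ENNReal.toReal_ofReal (by linarith), Measure.restrict_apply_univ, mul_assoc]
            simp only [ENNReal.toReal_one, div_one]
            gcongr
            exact Measure.restrict_le_self
    have hc : volume K ^ (1 - 1 / p) * ENNReal.ofReal M ≠ ⊤ := by
      refine ENNReal.mul_ne_top (ENNReal.rpow_ne_top_of_nonneg ?_ hKfin.ne) ENNReal.ofReal_ne_top
      rw [sub_nonneg, div_le_one (by linarith)]
      exact hp
    have h3 := ENNReal.Tendsto.mul_const hFG (Or.inr hc)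
    rw [zero_mul] at h3
    exact tendsto_of_tendsto_of_tendsto_of_le_of_le tendsto_const_nhds h3 (fun _ => bot_le) hbound
  have h3 := h2.neg
  refine tendsto_nhds_unique h1 (h3.congr fun k => ?_)
  exact ((hF k).3 φ hφ i).symm

theorem IsWeakGradient.sub {u v : EuclideanSpace ℝ (Fin n) → ℝ}
    {F G : EuclideanSpace ℝ (Fin n) → EuclideanSpace ℝ (Fin n)}
    (hF : IsWeakGradient u F) (hG : IsWeakGradient v G) : IsWeakGradient (u - v) (F - G) := by
  have := hF.add (hG.smul (-1))
  simpa [sub_eq_add_neg] using this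

/-- The limit of a pointwise convergent sequence that is Cauchy for the seminorm is also its limit
for the seminorm: by Fatou's lemma if `s < 1`, by completeness of `L^p` if `s = 1`. -/
theorem tendsto_gagliardo_sub (hp : 1 ≤ p)
    {v : ℕ → EuclideanSpace ℝ (Fin n) → ℝ} {u b : EuclideanSpace ℝ (Fin n) → ℝ}
    (hv : ∀ k, Continuous (v k)) (hvfin : ∀ k, gagliardo n s p (v k) < ⊤)
    (hcau : ∀ ε : ℝ≥0∞, ε ≠ 0 → ∃ N, ∀ k ≥ N, ∀ m ≥ N, gagliardo n s p (v k - v m) ≤ ε)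
    (hvu : ∀ x, Filter.Tendsto (fun k => v k x) Filter.atTop (𝓝 (u x))) (hu : Continuous u)
    (hb : Continuous b) (hvb : ∀ k x, ‖v k x‖ ≤ b x) :
    Filter.Tendsto (fun k => gagliardo n s p (u - v k)) Filter.atTop (𝓝 0) := by
  have hp0 : 0 < p := by linarith
  by_cases hs : s = 1
  · subst hs
    have : Fact (1 ≤ ENNReal.ofReal p) := ⟨by simpa using hp⟩
    simp only [gagliardo, if_true] at hvfin hcau ⊢
    choose F hF _ hFp using fun k => exists_isWeakGradient (hvfin k)
    have hcs : CauchySeq fun k => (hFp k).toLp (F k) := by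
      rw [EMetric.cauchySeq_iff]
      intro ε hε
      obtain ⟨N, hN⟩ := hcau (min (ε / 2) 1) (by simpa using hε.ne')
      refine ⟨N, fun k hk m hm => ?_⟩
      rw [Lp.edist_toLp_toLp, ← gradSeminorm_eq ((hF k).sub (hF m))]
      refine (hN k hk m hm).trans_lt ?_
      by_cases ht : ε = ⊤
      · simp [ht]
      · exact (min_le_left _ _).trans_lt (ENNReal.half_lt_self hε.ne' ht)
    obtain ⟨L, hL⟩ := cauchySeq_tendsto_of_complete hcs
    have hL' : Filter.Tendsto (fun k => eLpNorm (F k - ⇑L) (ENNReal.ofReal p) volume)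
        Filter.atTop (𝓝 0) := by
      rw [tendsto_iff_edist_tendsto_0] at hL
      refine hL.congr fun k => ?_
      rw [Lp.edist_def]
      refine eLpNorm_congr_ae ?_
      filter_upwards [(hFp k).coeFn_toLp] with x hx
      simp only [Pi.sub_apply, hx]
    have hG : IsWeakGradient u L := IsWeakGradient.of_tendsto hp hF (Lp.memLp L) hL' hvu hu hb hvb
    refine hL'.congr fun k => ?_
    rw [gradSeminorm_eq (hG.sub (hF k)), eLpNorm_sub_comm]
  · rw [ENNReal.tendsto_nhds_zero]
    intro ε hε
    obtain ⟨N, hN⟩ := hcau ε hε.ne'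
    filter_upwards [Filter.eventually_ge_atTop N] with m hm
    refine gagliardo_le_of_tendsto (w := fun k => v k - v m) hp0 hs
      (fun k => (hv k).sub (hv m)) (fun x => (hvu x).sub_const _) ?_
    filter_upwards [Filter.eventually_ge_atTop N] with k hk
    exact hN k hk m hm

variable (h : Exponents n s p) (hsp : (n : ℝ) < s * p)

/-- Every class has a representative vanishing at the origin. -/
theorem W.exists_mk_eq (w : W n s p h hsp) :
    ∃ f : holderSubmodule h hsp, W.mk h hsp f = w ∧ f.1 0 = 0 := by
  obtain ⟨f, rfl⟩ := W.mk_surjective h hsp w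
  have hc : (fun _ => f.1 0) ∈ holderSubmodule h hsp :=
    ⟨memHolder_const, (gagliardo_const (by linarith [h.one_le_p]) _).trans_lt (by simp)⟩
  refine ⟨f - ⟨_, hc⟩, ?_, by simp⟩
  rw [W.mk_eq_mk_iff]
  exact ⟨-f.1 0, fun x => by simp⟩

theorem W.eq_zero_of_norm_eq_zero (w : W n s p h hsp) (hw : ‖w‖ = 0) : w = 0 := by
  obtain ⟨f, rfl, hf0⟩ := W.exists_mk_eq h hsp w
  obtain ⟨C, -, hC⟩ := exists_norm_sub_le h hsp
  rw [W.norm_mk] at hw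
  rw [← map_zero (W.mk h hsp), W.mk_eq_mk_iff]
  refine ⟨0, fun x => ?_⟩
  have := hC f.1 f.2.1 f.2.2 x 0
  rw [hw, mul_zero, zero_mul, hf0, sub_zero] at this
  simpa using norm_le_zero_iff.1 this

/-- For representatives vanishing at the origin, the Morrey-type inequality turns a Cauchy sequence of
classes into a locally uniform Cauchy sequence of functions. -/
theorem W.completeSpace : CompleteSpace (W n s p h hsp) := by
  have hα := holderExponent_pos h hsp
  refine Metric.complete_of_cauchySeq_tendsto fun w hw => ?_
  choose f hfw hf0 using fun k => W.exists_mk_eq h hsp (w k)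
  obtain ⟨C, hC0, hC⟩ := exists_norm_sub_le h hsp
  have hcont : ∀ k, Continuous (f k).1 := fun k => continuous_of_memHolder hα (f k).2.1
  have hnorm : ∀ k m, (gagliardo n s p ((f k).1 - (f m).1)).toReal = dist (w k) (w m) := by
    intro k m
    rw [dist_eq_norm, ← hfw k, ← hfw m, ← map_sub, W.norm_mk]
    rfl
  have hdiff : ∀ k m x y, ‖((f k).1 x - (f m).1 x) - ((f k).1 y - (f m).1 y)‖ ≤
      C * dist (w k) (w m) * ‖x - y‖ ^ (s - n / p) := by
    intro k m x y
    rw [← hnorm]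
    exact hC _ (f k - f m).2.1 (f k - f m).2.2 x y
  have hdiff0 : ∀ k m x, ‖(f k).1 x - (f m).1 x‖ ≤
      C * dist (w k) (w m) * ‖x‖ ^ (s - n / p) := by
    intro k m x
    simpa [hf0] using hdiff k m x 0
  have hptc : ∀ x, CauchySeq fun k => (f k).1 x := by
    intro x
    rw [Metric.cauchySeq_iff'] at hw ⊢
    intro ε hε
    obtain ⟨N, hN⟩ := hw (ε / (C * ‖x‖ ^ (s - n / p) + 1)) (by positivity)
    refine ⟨N, fun k hk => ?_⟩
    rw [dist_eq_norm]
    refine (hdiff0 k N x).trans_lt ?_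
    have h1 := hN k hk
    rw [lt_div_iff₀ (by positivity)] at h1
    have h2 : 0 ≤ dist (w k) (w N) := dist_nonneg
    nlinarith
  choose u hu using fun x => cauchySeq_tendsto_of_complete (hptc x)
  obtain ⟨D, hD0, hD⟩ := cauchySeq_bdd hw
  have hfin : ∀ k, gagliardo n s p (f k).1 < ⊤ := fun k => (f k).2.2
  have huH : MemHolder (s - n / p).toNNReal u := by
    have h1 : HolderWith (C.toNNReal * D.toNNReal) (s - n / p).toNNReal (u - (f 0).1) := by
      rw [holderWith_iff_norm hα]
      intro x y
      have hlim : Filter.Tendsto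
          (fun k => ‖((f k).1 x - (f 0).1 x) - ((f k).1 y - (f 0).1 y)‖) Filter.atTop
          (𝓝 ‖(u x - (f 0).1 x) - (u y - (f 0).1 y)‖) :=
        (((hu x).sub_const _).sub ((hu y).sub_const _)).norm
      refine le_of_tendsto hlim (Filter.Eventually.of_forall fun k => (hdiff k 0 x y).trans ?_)
      rw [NNReal.coe_mul, Real.coe_toNNReal _ hC0, Real.coe_toNNReal _ hD0.le]
      gcongr
      exact (hD k 0).le
    simpa using h1.memHolder.add (f 0).2.1
  have huc : Continuous u := continuous_of_memHolder hα huH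
  have hlim := tendsto_gagliardo_sub (s := s) (u := u)
    (b := fun x => ‖(f 0).1 x‖ + C * D * ‖x‖ ^ (s - n / p)) h.one_le_p hcont hfin (by
      intro ε hε
      rw [Metric.cauchySeq_iff] at hw
      by_cases ht : ε = ⊤
      · exact ⟨0, fun _ _ _ _ => by simp [ht]⟩
      obtain ⟨N, hN⟩ := hw ε.toReal (ENNReal.toReal_pos hε ht)
      refine ⟨N, fun k hk m hm => ?_⟩
      refine (ENNReal.toReal_le_toReal (f k - f m).2.2.ne ht).1 ?_
      exact (hnorm k m).le.trans (hN k hk m hm).le) hu huc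
    (by
      have := hcont 0
      exact this.norm.add (continuous_const.mul (continuous_norm.rpow_const
        fun _ => Or.inr hα.le)))
    (by
      intro k x
      have h1 : (f k).1 x = (f 0).1 x + ((f k).1 x - (f 0).1 x) := by ring
      rw [h1]
      refine (norm_add_le _ _).trans ?_
      gcongr
      refine (hdiff0 k 0 x).trans ?_
      gcongr
      exact (hD k 0).le)
  have hufin : gagliardo n s p u < ⊤ := by
    obtain ⟨k, hk⟩ := (hlim.eventually (gt_mem_nhds ENNReal.zero_lt_top)).exists
    have h1 : u = (u - (f k).1) + (f k).1 := by simp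
    rw [h1]
    exact (gagliardo_add_le h.one_le_p (huc.sub (hcont k)) (hcont k)).trans_lt
      (ENNReal.add_lt_top.2 ⟨hk, hfin k⟩)
  refine ⟨W.mk h hsp ⟨u, huH, hufin⟩, ?_⟩
  rw [tendsto_iff_dist_tendsto_zero]
  have h1 := (ENNReal.tendsto_toReal ENNReal.zero_ne_top).comp hlim
  refine h1.congr fun k => ?_
  rw [dist_comm, dist_eq_norm, ← hfw k, ← map_sub, W.norm_mk]
  rfl

end Completeness

/-! ### Approximation of compactly supported functions by mollification -/

section MollificationApprox

variable {n : ℕ} {s p : ℝ}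

/-- The weighted difference quotient `(u x - u y) / |x - y| ^ ((n + s p) / p)`, whose `L^p` norm on
`ℝⁿ × ℝⁿ` is the Gagliardo seminorm up to a factor. -/
def diffQuot (n : ℕ) (s p : ℝ) (u : EuclideanSpace ℝ (Fin n) → ℝ)
    (z : EuclideanSpace ℝ (Fin n) × EuclideanSpace ℝ (Fin n)) : ℝ :=
  (‖z.1 - z.2‖ ^ (((n : ℝ) + s * p) / p))⁻¹ * (u z.1 - u z.2)

theorem lintegral_diffQuot (hp : 0 < p)
    (u : EuclideanSpace ℝ (Fin n) → ℝ) :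
    ∫⁻ z, ‖diffQuot n s p u z‖ₑ ^ p = gagliardoIntegral n s p u := by
  unfold gagliardoIntegral
  refine lintegral_congr fun z => ?_
  rcases eq_or_ne z.1 z.2 with hz | hz
  · simp [diffQuot, hz, hp]
  have hpos : 0 < ‖z.1 - z.2‖ := norm_pos_iff.2 (sub_ne_zero.2 hz)
  rw [diffQuot, enorm_mul, ENNReal.mul_rpow_of_nonneg _ _ hp.le, mul_comm, div_eq_mul_inv,
    enorm_inv (by positivity), ENNReal.inv_rpow]
  congr 2
  rw [← div_eq_mul_inv, Real.enorm_of_nonneg (by positivity),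
    ENNReal.ofReal_rpow_of_pos (by positivity), ← Real.rpow_mul hpos.le, div_mul_cancel₀ _ hp.ne', ← ENNReal.ofReal_rpow_of_pos hpos,
    ofReal_norm]

theorem gagliardo_eq_eLpNorm_diffQuot (hp : 0 < p) (hs : s ≠ 1)
    (u : EuclideanSpace ℝ (Fin n) → ℝ) :
    gagliardo n s p u = ENNReal.ofReal (s * (1 - s)) ^ (1 / p) *
      eLpNorm (diffQuot n s p u) (ENNReal.ofReal p) volume := by
  rw [gagliardo, if_neg hs, ENNReal.mul_rpow_of_nonneg _ _ (by positivity),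
    ← lintegral_diffQuot hp, eLpNorm_eq_lintegral_rpow_enorm_toReal (by simpa using hp)
      (by simp), ENNReal.toReal_ofReal hp.le]

theorem measurable_diffQuot {u : EuclideanSpace ℝ (Fin n) → ℝ} (hu : Continuous u) :
    Measurable (diffQuot n s p u) := by
  refine Measurable.mul ?_ (Continuous.measurable (by fun_prop))
  exact ((Continuous.measurable (by fun_prop)).pow_const _).inv

theorem diffQuot_mollify (φ : ContDiffBump (0 : EuclideanSpace ℝ (Fin n)))
    {u : EuclideanSpace ℝ (Fin n) → ℝ} (hu : Continuous u)
    (z : EuclideanSpace ℝ (Fin n) × EuclideanSpace ℝ (Fin n)) :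
    diffQuot n s p (mollify φ u) z = ∫ t, diffQuot n s p u (z - (t, t)) ∂bumpMeasure φ := by
  have hint : ∀ x, Integrable (fun t => u (x - t)) (bumpMeasure φ) := fun x =>
    integrable_bumpMeasure φ (by fun_prop : Continuous fun t => u (x - t)).locallyIntegrable
  simp only [diffQuot, Prod.fst_sub, Prod.snd_sub, sub_sub_sub_cancel_right]
  rw [integral_const_mul, integral_sub (hint _) (hint _)]
  rfl

theorem diffQuot_sub (u v : EuclideanSpace ℝ (Fin n) → ℝ) :
    diffQuot n s p (u - v) = diffQuot n s p u - diffQuot n s p v := by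
  ext z
  simp only [diffQuot, Pi.sub_apply]
  ring

theorem gagliardo_neg (hp : 0 < p) (u : EuclideanSpace ℝ (Fin n) → ℝ) :
    gagliardo n s p (-u) = gagliardo n s p u := by
  have key : ∀ v : EuclideanSpace ℝ (Fin n) → ℝ, gagliardo n s p (-v) ≤ gagliardo n s p v := by
    intro v
    simpa using gagliardo_smul_le (n := n) (s := s) (u := v) hp (-1)
  exact le_antisymm (key u) (by simpa using key (-u))

/-- Continuous compactly supported functions with finite seminorm are approximated by test
functions: mollification averages translates of the weighted difference quotient (`s < 1`) or of the
weak gradient (`s = 1`), and translations are continuous in `L^p`. -/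
theorem exists_isTest_gagliardo_sub_le (h : Exponents n s p) {w : EuclideanSpace ℝ (Fin n) → ℝ}
    (hw : Continuous w) (hc : HasCompactSupport w) (hfin : gagliardo n s p w < ⊤)
    {ε : ℝ≥0∞} (hε : ε ≠ 0) : ∃ φ, IsTest φ ∧ gagliardo n s p (w - φ) ≤ ε := by
  have hp0 : 0 < p := by linarith [h.one_le_p]
  have hp1 : 1 ≤ ENNReal.ofReal p := by simpa using h.one_le_p
  obtain ⟨φ, hφ⟩ := exists_bump_seq n
  have hball : ∀ U ∈ 𝓝 (0 : EuclideanSpace ℝ (Fin n)), ∃ k, ∀ᵐ t ∂bumpMeasure (φ k), t ∈ U := by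
    intro U hU
    obtain ⟨δ, hδ, hδU⟩ := Metric.mem_nhds_iff.1 hU
    obtain ⟨k, hk⟩ := (hφ.eventually (gt_mem_nhds hδ)).exists
    refine ⟨k, ?_⟩
    filter_upwards [ae_bumpMeasure_norm_lt (φ k)] with t ht
    exact hδU (mem_ball_zero_iff.2 (ht.trans hk))
  by_cases hs : s = 1
  · subst hs
    simp only [gagliardo, if_true] at hfin ⊢
    obtain ⟨G, hG, hGm, hGp⟩ := exists_isWeakGradient hfin
    obtain ⟨k, hk⟩ := hball _ ((tendsto_eLpNorm_translate_sub hp1 (by simp) hGp).eventually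
      (ge_mem_nhds (pos_iff_ne_zero.2 hε)))
    refine ⟨mollify (φ k) w, isTest_mollify (φ k) hw hc, ?_⟩
    have hH := isWeakGradient_of_hasGradientAt (hG.hasGradientAt_mollify (φ k))
      (continuous_mollify (φ k) hG.2)
    rw [gradSeminorm_eq (hG.sub hH), eLpNorm_sub_comm]
    exact eLpNorm_average_translate_sub_le (τ := id) h.one_le_p hGm measurable_id
      (fun x => integrable_bumpMeasure (φ k) (locallyIntegrable_comp_sub_left hG.2 x)) hk
  · set c : ℝ≥0∞ := ENNReal.ofReal (s * (1 - s)) ^ (1 / p) with hcdef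
    have hc0 : c ≠ 0 := by
      have h1 : 0 < s * (1 - s) :=
        mul_pos h.s_pos (sub_pos.2 (lt_of_le_of_ne h.s_le_one hs))
      rw [hcdef, ENNReal.ofReal_rpow_of_pos h1]
      simpa using Real.rpow_pos_of_pos h1 _
    have hct : c ≠ ⊤ := ENNReal.rpow_ne_top_of_nonneg (by positivity) ENNReal.ofReal_ne_top
    have hUm := measurable_diffQuot (s := s) (p := p) hw
    have hU : MemLp (diffQuot n s p w) (ENNReal.ofReal p) volume := by
      refine ⟨hUm.aestronglyMeasurable, ?_⟩
      rw [gagliardo_eq_eLpNorm_diffQuot hp0 hs, ← hcdef] at hfin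
      refine lt_top_iff_ne_top.2 fun ht => ?_
      rw [ht, ENNReal.mul_top hc0] at hfin
      exact lt_irrefl _ hfin
    have : (volume : Measure (EuclideanSpace ℝ (Fin n) × EuclideanSpace ℝ (Fin n))).IsAddHaarMeasure
      := Measure.prod.instIsAddHaarMeasure _ _
    have hτ : Filter.Tendsto (fun t : EuclideanSpace ℝ (Fin n) => (t, t)) (𝓝 0) (𝓝 0) :=
      (Continuous.tendsto (by fun_prop) 0)
    obtain ⟨k, hk⟩ := hball _ (((tendsto_eLpNorm_translate_sub hp1 (by simp) hU).comp hτ).eventually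
      (ge_mem_nhds (pos_iff_ne_zero.2 (ENNReal.div_ne_zero.2 ⟨hε, hct⟩))))
    refine ⟨mollify (φ k) w, isTest_mollify (φ k) hw hc, ?_⟩
    rw [gagliardo_eq_eLpNorm_diffQuot hp0 hs, ← hcdef, mul_comm,
      ← ENNReal.le_div_iff_mul_le (Or.inl hc0) (Or.inl hct), diffQuot_sub, eLpNorm_sub_comm]
    have hmain := eLpNorm_average_translate_sub_le (μ := volume) (ν := bumpMeasure (φ k))
      (F := diffQuot n s p w) (τ := fun t : EuclideanSpace ℝ (Fin n) => (t, t)) h.one_le_p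
      hUm.stronglyMeasurable (by fun_prop) (fun z => by
        refine integrable_bumpMeasure (φ k) (Continuous.locallyIntegrable ?_)
        simp only [diffQuot, Prod.fst_sub, Prod.snd_sub, sub_sub_sub_cancel_right]
        fun_prop) hk
    simp only [← diffQuot_mollify (φ k) hw] at hmain
    exact hmain

end MollificationApprox

/-! ### Cutoff functions and the Gagliardo integral -/

section Cutoff

variable {n : ℕ} {s p : ℝ}

/-- `η` is a smooth cutoff function at scale `R`: it equals `1` on the ball of radius `R`, vanishes
outside that of radius `2 R`, and has Lipschitz constant `L / R`. -/
structure IsCutoff (L R : ℝ) (η : EuclideanSpace ℝ (Fin n) → ℝ) : Prop where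
  contDiff : ContDiff ℝ ((⊤ : ℕ∞) : WithTop ℕ∞) η
  nonneg : ∀ x, 0 ≤ η x
  le_one : ∀ x, η x ≤ 1
  eq_one : ∀ x, ‖x‖ ≤ R → η x = 1
  eq_zero : ∀ x, 2 * R ≤ ‖x‖ → η x = 0
  norm_sub_le : ∀ x y, ‖η x - η y‖ ≤ L * (‖x - y‖ / R)

theorem exists_isCutoff (n : ℕ) : ∃ L : ℝ, 1 ≤ L ∧ ∀ R : ℝ, 0 < R →
    ∃ η : EuclideanSpace ℝ (Fin n) → ℝ, IsCutoff L R η := by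
  let b : ContDiffBump (0 : EuclideanSpace ℝ (Fin n)) := ⟨1, 2, one_pos, one_lt_two⟩
  obtain ⟨K, hK⟩ := (b.contDiff (n := 1)).lipschitzWith_of_hasCompactSupport b.hasCompactSupport
    (by simp)
  refine ⟨max K 1, le_max_right _ _, fun R hR => ⟨fun x => b (R⁻¹ • x), ?_⟩⟩
  have hnorm : ∀ x : EuclideanSpace ℝ (Fin n), ‖R⁻¹ • x‖ = ‖x‖ / R := by
    intro x
    rw [norm_smul, Real.norm_of_nonneg (by positivity), div_eq_inv_mul]
  refine ⟨b.contDiff.comp (contDiff_const_smul _), fun _ => b.nonneg, fun _ => b.le_one,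
    fun x hx => ?_, fun x hx => ?_, fun x y => ?_⟩
  · refine b.one_of_mem_closedBall ?_
    rw [mem_closedBall_zero_iff, hnorm, div_le_iff₀ hR]
    simpa [b] using hx
  · refine b.zero_of_le_dist ?_
    rw [dist_zero_right, hnorm, le_div_iff₀ hR]
    simpa [b] using hx
  · refine (hK.norm_sub_le _ _).trans ?_
    rw [← smul_sub, hnorm]
    gcongr
    exact le_max_left _ _

namespace IsCutoff

variable {L R : ℝ} {η v : EuclideanSpace ℝ (Fin n) → ℝ}

theorem hasCompactSupport (h : IsCutoff L R η) : HasCompactSupport η :=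
  HasCompactSupport.intro (isCompact_closedBall (0 : EuclideanSpace ℝ (Fin n)) (2 * R))
    fun x hx => h.eq_zero x (by
      rw [mem_closedBall_zero_iff, not_le] at hx
      exact hx.le)

theorem norm_sub_le_min (h : IsCutoff L R η) (hL : 1 ≤ L) (x y : EuclideanSpace ℝ (Fin n)) :
    ‖η x - η y‖ ≤ L * min (‖x - y‖ / R) 1 := by
  rw [mul_min_of_nonneg _ _ (by linarith), mul_one]
  refine le_min (h.norm_sub_le x y) (le_trans ?_ hL)
  rw [Real.norm_eq_abs, abs_sub_le_iff]
  constructor <;> linarith [h.nonneg x, h.nonneg y, h.le_one x, h.le_one y]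

theorem norm_gradient_le (h : IsCutoff L R η) (hL : 0 ≤ L) (hR : 0 < R)
    (x : EuclideanSpace ℝ (Fin n)) : ‖gradient η x‖ ≤ L / R := by
  have hl : LipschitzWith (L / R).toNNReal η := LipschitzWith.of_dist_le_mul fun x y => by
    rw [Real.coe_toNNReal _ (by positivity), dist_eq_norm, dist_eq_norm]
    refine (h.norm_sub_le x y).trans (le_of_eq ?_)
    ring
  have h1 := norm_fderiv_le_of_lipschitz ℝ hl (x₀ := x)
  rw [Real.coe_toNNReal _ (by positivity)] at h1
  rwa [gradient, LinearIsometryEquiv.norm_map]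

theorem gradient_eq_zero (h : IsCutoff L R η) {x : EuclideanSpace ℝ (Fin n)}
    (hx : ‖x‖ < R ∨ 2 * R < ‖x‖) : gradient η x = 0 := by
  rcases hx with hx | hx
  · have he : η =ᶠ[𝓝 x] fun _ => 1 := by
      filter_upwards [(isOpen_lt continuous_norm continuous_const).mem_nhds hx] with y hy
      exact h.eq_one y (le_of_lt hy)
    rw [gradient, he.fderiv_eq]
    simp
  · have he : η =ᶠ[𝓝 x] fun _ => 0 := by
      filter_upwards [(isOpen_lt continuous_const continuous_norm).mem_nhds hx] with y hy
      exact h.eq_zero y (le_of_lt hy)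
    rw [gradient, he.fderiv_eq]
    simp

end IsCutoff

/-- The radial kernel `min(|h|, 1)^p / |h|^(n + s p)`, with values in `[0, ∞]`. -/
def kernel (n : ℕ) (s p : ℝ) (x : EuclideanSpace ℝ (Fin n)) : ℝ≥0∞ :=
  ENNReal.ofReal (min ‖x‖ 1 ^ p / ‖x‖ ^ ((n : ℝ) + s * p))

theorem measurable_kernel : Measurable (kernel n s p) := by
  refine ENNReal.measurable_ofReal.comp (Measurable.div ?_ ?_)
  · exact (measurable_norm.min measurable_const).pow_const _
  · exact measurable_norm.pow_const _

theorem lintegral_kernel_lt_top (h : Exponents n s p) (hs : s < 1) :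
    ∫⁻ x, kernel n s p x < ⊤ := (integrable_kernel h hs).lintegral_lt_top

theorem lintegral_kernel_smul {R : ℝ} (hR : 0 < R) :
    ∫⁻ x, kernel n s p (R⁻¹ • x) = ENNReal.ofReal (R ^ n) * ∫⁻ x, kernel n s p x := by
  have h1 := Measure.map_addHaar_smul (volume : Measure (EuclideanSpace ℝ (Fin n)))
    (inv_ne_zero hR.ne')
  rw [← lintegral_map measurable_kernel (by fun_prop : Measurable fun x => R⁻¹ • x), h1,
    lintegral_smul_measure, finrank_euclideanSpace, Fintype.card_fin, inv_pow, inv_inv,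
    abs_of_pos (by positivity), smul_eq_mul]

theorem min_rpow_div_eq {R : ℝ} (hR : 0 < R) (x : EuclideanSpace ℝ (Fin n)) :
    ENNReal.ofReal (min (‖x‖ / R) 1 ^ p / ‖x‖ ^ ((n : ℝ) + s * p)) =
      ENNReal.ofReal (R ^ (-((n : ℝ) + s * p))) * kernel n s p (R⁻¹ • x) := by
  have hnorm : ‖R⁻¹ • x‖ = ‖x‖ / R := by
    rw [norm_smul, Real.norm_of_nonneg (by positivity), div_eq_inv_mul]
  rw [kernel, ← ENNReal.ofReal_mul (by positivity), hnorm, Real.div_rpow (norm_nonneg _) hR.le,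
    Real.rpow_neg hR.le]
  congr 1
  have : R ^ ((n : ℝ) + s * p) ≠ 0 := by positivity
  field_simp

/-- If `w` vanishes outside `B` and its increments exceed those of `v` by at most
`A min(|x - y| / R, 1)` when `x ∈ B`, then the Gagliardo integral of `w` is controlled by that of
`v`. -/
theorem gagliardoIntegral_le_of_norm_sub_le (h : Exponents n s p) {A R : ℝ} (hA : 0 ≤ A)
    (hR : 0 < R) {v w : EuclideanSpace ℝ (Fin n) → ℝ} (hv : Continuous v)
    {B : Set (EuclideanSpace ℝ (Fin n))} (hB : MeasurableSet B) (hwB : ∀ x ∉ B, w x = 0)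
    (hvw : ∀ x ∈ B, ∀ y, ‖w x - w y‖ ≤ ‖v x - v y‖ + A * min (‖x - y‖ / R) 1) :
    gagliardoIntegral n s p w ≤ 2 ^ (p - 1) * (gagliardoIntegral n s p v +
      2 * (ENNReal.ofReal (A ^ p * R ^ (-(s * p))) * volume B * ∫⁻ x, kernel n s p x)) := by
  have hp0 : 0 < p := by linarith [h.one_le_p]
  set k : EuclideanSpace ℝ (Fin n) → ℝ≥0∞ := fun x =>
    ENNReal.ofReal (A ^ p) * (ENNReal.ofReal (R ^ (-((n : ℝ) + s * p))) * kernel n s p (R⁻¹ • x))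
    with hk
  have hkm : Measurable k :=
    ((measurable_kernel.comp (measurable_const_smul R⁻¹)).const_mul _).const_mul _
  have hkint : ∫⁻ x, k x = ENNReal.ofReal (A ^ p * R ^ (-(s * p))) * ∫⁻ x, kernel n s p x := by
    have hkm' : Measurable fun x => kernel n s p (R⁻¹ • x) :=
      measurable_kernel.comp (measurable_const_smul R⁻¹)
    rw [hk, lintegral_const_mul _ (hkm'.const_mul _), lintegral_const_mul _ hkm',
      lintegral_kernel_smul hR, ← mul_assoc, ← mul_assoc, ← ENNReal.ofReal_mul (by positivity),
      ← ENNReal.ofReal_mul (by positivity), neg_add, Real.rpow_add hR, Real.rpow_neg hR.le,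
      Real.rpow_natCast]
    congr 2
    field_simp
  have hind : Measurable (B.indicator (1 : EuclideanSpace ℝ (Fin n) → ℝ≥0∞)) :=
    measurable_one.indicator hB
  have hI : ∫⁻ x, B.indicator (1 : EuclideanSpace ℝ (Fin n) → ℝ≥0∞) x = volume B :=
    lintegral_indicator_one hB
  set g : EuclideanSpace ℝ (Fin n) × EuclideanSpace ℝ (Fin n) → ℝ≥0∞ := fun z =>
    ‖v z.1 - v z.2‖ₑ ^ p / ‖z.1 - z.2‖ₑ ^ ((n : ℝ) + s * p)
  have hgm : Measurable g := by
    exact ((Continuous.measurable (by fun_prop)).enorm.pow_const _).div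
        ((Continuous.measurable (by fun_prop)).enorm.pow_const _)
  have hpt : ∀ z : EuclideanSpace ℝ (Fin n) × EuclideanSpace ℝ (Fin n),
      ‖w z.1 - w z.2‖ₑ ^ p / ‖z.1 - z.2‖ₑ ^ ((n : ℝ) + s * p) ≤
        2 ^ (p - 1) * (g z + (B.indicator 1 z.1 * k (z.1 - z.2) +
          B.indicator 1 z.2 * k (z.1 - z.2))) := by
    rintro ⟨x, y⟩
    have key : ‖w x - w y‖ ≤ ‖v x - v y‖ + A * min (‖x - y‖ / R) 1 →
        ‖w x - w y‖ₑ ^ p / ‖x - y‖ₑ ^ ((n : ℝ) + s * p) ≤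
          2 ^ (p - 1) * (g (x, y) + k (x - y)) := by
      intro hxy
      rcases eq_or_ne x y with rfl | hne
      · simp [hp0]
      have hpos : 0 < ‖x - y‖ := norm_pos_iff.2 (sub_ne_zero.2 hne)
      have h1 : ‖w x - w y‖ₑ ≤ ‖v x - v y‖ₑ + ENNReal.ofReal (A * min (‖x - y‖ / R) 1) := by
        rw [← ofReal_norm, ← ofReal_norm, ← ENNReal.ofReal_add (norm_nonneg _) (by positivity)]
        exact ENNReal.ofReal_le_ofReal hxy
      have h2 : k (x - y) = ENNReal.ofReal (A * min (‖x - y‖ / R) 1) ^ p /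
          ‖x - y‖ₑ ^ ((n : ℝ) + s * p) := by
        rw [hk]
        simp only
        rw [← min_rpow_div_eq hR, ENNReal.ofReal_rpow_of_nonneg (by positivity) hp0.le,
          ← ofReal_norm, ENNReal.ofReal_rpow_of_pos hpos,
          ← ENNReal.ofReal_div_of_pos (by positivity), Real.mul_rpow hA (by positivity),
          ← ENNReal.ofReal_mul (by positivity), mul_div_assoc]
      rw [h2, ← ENNReal.add_div, ← mul_div_assoc]
      gcongr
      exact (ENNReal.rpow_le_rpow h1 hp0.le).trans
        (ENNReal.rpow_add_le_mul_rpow_add_rpow _ _ h.one_le_p)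
    by_cases hx : x ∈ B
    · refine (key (hvw x hx y)).trans ?_
      simp only [Set.indicator_of_mem hx, Pi.one_apply, one_mul]
      gcongr
      exact le_self_add
    · by_cases hy : y ∈ B
      · refine (key ?_).trans ?_
        · rw [norm_sub_rev (w x), norm_sub_rev (v x), norm_sub_rev x]
          exact hvw y hy x
        · simp only [Set.indicator_of_mem hy, Pi.one_apply, one_mul]
          gcongr
          exact le_add_self
      · simp [hwB x hx, hwB y hy, hp0]
  have e1 : ∫⁻ z : EuclideanSpace ℝ (Fin n) × EuclideanSpace ℝ (Fin n),
      B.indicator 1 z.1 * k (z.1 - z.2) = volume B * ∫⁻ x, k x := by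
    rw [Measure.volume_eq_prod, lintegral_prod _ (by fun_prop)]
    have e : ∀ x, ∫⁻ y, B.indicator 1 x * k (x - y) = B.indicator 1 x * ∫⁻ y, k y := by
      intro x
      rw [lintegral_const_mul _ (by fun_prop), lintegral_sub_left_eq_self k]
    rw [lintegral_congr e, lintegral_mul_const _ hind, hI]
  have e2 : ∫⁻ z : EuclideanSpace ℝ (Fin n) × EuclideanSpace ℝ (Fin n),
      B.indicator 1 z.2 * k (z.1 - z.2) = volume B * ∫⁻ x, k x := by
    rw [Measure.volume_eq_prod, lintegral_prod_symm _ (by fun_prop)]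
    have e : ∀ y, ∫⁻ x, B.indicator 1 y * k (x - y) = B.indicator 1 y * ∫⁻ x, k x := by
      intro y
      rw [lintegral_const_mul _ (by fun_prop), lintegral_sub_right_eq_self k]
    rw [lintegral_congr e, lintegral_mul_const _ hind, hI]
  calc gagliardoIntegral n s p w ≤ ∫⁻ z, 2 ^ (p - 1) * (g z + (B.indicator 1 z.1 * k (z.1 - z.2) +
          B.indicator 1 z.2 * k (z.1 - z.2))) := lintegral_mono hpt
    _ = 2 ^ (p - 1) * (gagliardoIntegral n s p v + (volume B * ∫⁻ x, k x) +
          (volume B * ∫⁻ x, k x)) := by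
        rw [lintegral_const_mul _ (by fun_prop), lintegral_add_left hgm,
          lintegral_add_left (by fun_prop), e1, e2, add_assoc]
        rfl
    _ = _ := by
        rw [hkint, add_assoc, ← two_mul]
        ring_nf

end Cutoff

/-! ### Approximation by compactly supported functions -/

section CutoffApprox

variable {n : ℕ} {s p L K : ℝ} {v : EuclideanSpace ℝ (Fin n) → ℝ}

/-- The increments of `v η` from a point of the support of `η`, for `v` of growth `|x| ^ α`. -/
theorem IsCutoff.norm_mul_sub_mul_le {R : ℝ} {η : EuclideanSpace ℝ (Fin n) → ℝ}
    (hη : IsCutoff L R η) (hL : 1 ≤ L) (hR : 0 < R) {α : ℝ} (hα : 0 ≤ α) (hK : 0 ≤ K)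
    (hvK : ∀ x, ‖v x‖ ≤ K * ‖x‖ ^ α) {x : EuclideanSpace ℝ (Fin n)} (hx : ‖x‖ < 2 * R)
    (y : EuclideanSpace ℝ (Fin n)) :
    ‖v x * η x - v y * η y‖ ≤ ‖v x - v y‖ + K * (2 * R) ^ α * L * min (‖x - y‖ / R) 1 := by
  have h1 : v x * η x - v y * η y = (v x - v y) * η y + v x * (η x - η y) := by ring
  have h2 : ‖v x‖ ≤ K * (2 * R) ^ α := (hvK x).trans (by gcongr)
  have h3 : ‖η y‖ ≤ 1 := by
    rw [Real.norm_of_nonneg (hη.nonneg y)]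
    exact hη.le_one y
  rw [h1]
  refine (norm_add_le _ _).trans ?_
  rw [norm_mul, norm_mul, mul_assoc _ L]
  exact add_le_add (mul_le_of_le_one_right (norm_nonneg _) h3)
    (mul_le_mul h2 (hη.norm_sub_le_min hL x y) (norm_nonneg _) (by positivity))

/-- Scale invariance: the bound for the cutoff error at scale `R` does not depend on `R`. -/
theorem cutoff_scale_invariance (hp : 0 < p) {R : ℝ} (hR : 0 < R) (hK : 0 ≤ K) (hL : 0 ≤ L) :
    (K * (2 * R) ^ (s - n / p) * L) ^ p * R ^ (-(s * p)) * (2 * R) ^ n = (K * 2 ^ s * L) ^ p := by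
  have h2R : 0 < 2 * R := by positivity
  rw [Real.mul_rpow (by positivity) hL, Real.mul_rpow hK (by positivity),
    Real.mul_rpow (by positivity) hL, Real.mul_rpow hK (by positivity), ← Real.rpow_mul h2R.le,
    ← Real.rpow_mul (by norm_num), ← Real.rpow_natCast]
  have e : (2 * R) ^ ((s - n / p) * p) * (2 * R) ^ (n : ℝ) = 2 ^ (s * p) * R ^ (s * p) := by
    rw [← Real.rpow_add h2R, ← Real.mul_rpow (by norm_num) hR.le]
    congr 1
    field_simp
    ring
  have e' : R ^ (s * p) * R ^ (-(s * p)) = 1 := by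
    rw [← Real.rpow_add hR, add_neg_cancel, Real.rpow_zero]
  calc _ = K ^ p * L ^ p * R ^ (-(s * p)) *
        ((2 * R) ^ ((s - n / p) * p) * (2 * R) ^ (n : ℝ)) := by ring
    _ = K ^ p * 2 ^ (s * p) * L ^ p * (R ^ (s * p) * R ^ (-(s * p))) := by
        rw [e]
        ring
    _ = _ := by rw [e', mul_one]

theorem volume_ball_eq (hn : 1 ≤ n) {r : ℝ} (hr : 0 ≤ r) :
    volume (Metric.ball (0 : EuclideanSpace ℝ (Fin n)) r) =
      ENNReal.ofReal (r ^ n) * volume (Metric.ball (0 : EuclideanSpace ℝ (Fin n)) 1) := by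
  have : Nonempty (Fin n) := ⟨⟨0, hn⟩⟩
  rw [Measure.addHaar_ball _ _ hr, finrank_euclideanSpace, Fintype.card_fin]

theorem IsCutoff.gagliardoIntegral_mul_le (h : Exponents n s p) (hsp : (n : ℝ) < s * p)
    (hL : 1 ≤ L) (hK : 0 ≤ K) (hv : Continuous v) (hvK : ∀ x, ‖v x‖ ≤ K * ‖x‖ ^ (s - n / p))
    {R : ℝ} (hR : 0 < R) {η : EuclideanSpace ℝ (Fin n) → ℝ} (hη : IsCutoff L R η) :
    gagliardoIntegral n s p (fun x => v x * η x) ≤ 2 ^ (p - 1) * (gagliardoIntegral n s p v +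
      2 * (ENNReal.ofReal ((K * 2 ^ s * L) ^ p) *
        volume (Metric.ball (0 : EuclideanSpace ℝ (Fin n)) 1) * ∫⁻ x, kernel n s p x)) := by
  have hp0 : 0 < p := by linarith [h.one_le_p]
  have key := gagliardoIntegral_le_of_norm_sub_le (w := fun x => v x * η x)
    (B := Metric.ball 0 (2 * R)) (A := K * (2 * R) ^ (s - n / p) * L) h (by positivity) hR hv
    measurableSet_ball (fun x hx => by
      rw [mem_ball_zero_iff, not_lt] at hx
      rw [hη.eq_zero x hx, mul_zero])
    (fun x hx y => hη.norm_mul_sub_mul_le hL hR (holderExponent_pos h hsp).le hK hvK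
      (mem_ball_zero_iff.1 hx) y)
  rwa [volume_ball_eq h.one_le_n (by positivity), ← mul_assoc (ENNReal.ofReal _)
    (ENNReal.ofReal _), ← ENNReal.ofReal_mul (by positivity),
    cutoff_scale_invariance hp0 hR hK (by linarith)] at key

theorem IsCutoff.eLpNorm_smul_gradient_le (h : Exponents n 1 p) (hnp : (n : ℝ) < 1 * p)
    (hL : 1 ≤ L) (hK : 0 ≤ K) (hvK : ∀ x, ‖v x‖ ≤ K * ‖x‖ ^ (1 - n / p))
    {R : ℝ} (hR : 0 < R) {η : EuclideanSpace ℝ (Fin n) → ℝ} (hη : IsCutoff L R η) :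
    eLpNorm (fun x => v x • gradient η x) (ENNReal.ofReal p) volume ≤
      (ENNReal.ofReal ((K * 2 ^ (1 : ℝ) * L) ^ p) *
        volume (Metric.ball (0 : EuclideanSpace ℝ (Fin n)) 1)) ^ (1 / p) := by
  have hp0 : 0 < p := by linarith [h.one_le_p]
  have hα := holderExponent_pos h hnp
  rw [eLpNorm_le_iff_lintegral hp0, ← ENNReal.rpow_mul, one_div_mul_cancel hp0.ne',
    ENNReal.rpow_one]
  set A : ℝ := K * (2 * R) ^ (1 - n / p) * L with hA
  -- the gradient of `η` vanishes inside and outside, but this is not clear on the sphere itself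
  have hnull : ∀ᵐ x : EuclideanSpace ℝ (Fin n), x ∉ Metric.sphere 0 (2 * R) := by
    have : Nonempty (Fin n) := ⟨⟨0, h.one_le_n⟩⟩
    exact measure_eq_zero_iff_ae_notMem.1 (Measure.addHaar_sphere _ _ _)
  calc ∫⁻ x, ‖v x • gradient η x‖ₑ ^ p
      ≤ ∫⁻ x, (Metric.ball (0 : EuclideanSpace ℝ (Fin n)) (2 * R)).indicator
          (fun _ => ENNReal.ofReal (A ^ p * R ^ (-(1 * p)))) x := by
        refine lintegral_mono_ae ?_
        filter_upwards [hnull] with x hx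
        rw [mem_sphere_zero_iff_norm] at hx
        rcases lt_or_gt_of_ne hx with hx | hx
        · rw [Set.indicator_of_mem (mem_ball_zero_iff.2 hx), ← ofReal_norm,
            ENNReal.ofReal_rpow_of_nonneg (norm_nonneg _) hp0.le]
          refine ENNReal.ofReal_le_ofReal ?_
          rw [one_mul, Real.rpow_neg hR.le, ← div_eq_mul_inv,
            ← Real.div_rpow (by positivity) hR.le, norm_smul, hA, mul_div_assoc]
          gcongr
          · exact (hvK x).trans (by gcongr)
          · exact hη.norm_gradient_le (by linarith) hR x
        · rw [hη.gradient_eq_zero (Or.inr hx)]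
          simp [hp0]
    _ = _ := by
        rw [lintegral_indicator measurableSet_ball, setLIntegral_const,
          volume_ball_eq h.one_le_n (by positivity), ← mul_assoc,
          ← ENNReal.ofReal_mul (by positivity), cutoff_scale_invariance hp0 hR hK (by linarith)]

theorem IsWeakGradient.average {f : ℕ → EuclideanSpace ℝ (Fin n) → ℝ}
    {F : ℕ → EuclideanSpace ℝ (Fin n) → EuclideanSpace ℝ (Fin n)}
    (hF : ∀ k, IsWeakGradient (f k) (F k)) (c : ℝ) (N : ℕ) :
    IsWeakGradient (fun x => c • ∑ i ∈ Finset.range N, f i x)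
      (fun x => c • ∑ i ∈ Finset.range N, F i x) := by
  have key : IsWeakGradient (fun x => ∑ i ∈ Finset.range N, f i x)
      (fun x => ∑ i ∈ Finset.range N, F i x) := by
    induction N with
    | zero =>
      simp only [Finset.range_zero, Finset.sum_empty]
      exact IsWeakGradient.const 0
    | succ N ih =>
      simp only [Finset.sum_range_succ]
      exact ih.add (hF N)
  exact key.smul c

theorem diffQuot_average (f : ℕ → EuclideanSpace ℝ (Fin n) → ℝ) (c : ℝ) (N : ℕ) :
    diffQuot n s p (fun x => c • ∑ i ∈ Finset.range N, f i x) =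
      fun z => c • ∑ i ∈ Finset.range N, diffQuot n s p (f i) z := by
  ext z
  simp only [diffQuot, smul_eq_mul, ← Finset.mul_sum, Finset.sum_sub_distrib]
  ring

/-- Arithmetic means of the errors `v - v η_R` made by cutting off `v` at different scales `R` have
arbitrarily small seminorm. A single error need not be small: by scale invariance these are only
bounded. -/
theorem exists_average_gagliardo_le (h : Exponents n s p) (hsp : (n : ℝ) < s * p)
    (hL : 1 ≤ L) (hK : 0 ≤ K) (hv : Continuous v) (hvK : ∀ x, ‖v x‖ ≤ K * ‖x‖ ^ (s - n / p))
    (hfin : gagliardo n s p v < ⊤) {η : ℕ → EuclideanSpace ℝ (Fin n) → ℝ}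
    (hη : ∀ k : ℕ, IsCutoff L ((k : ℝ) + 1) (η k)) {ε : ℝ≥0∞} (hε : ε ≠ 0) :
    ∃ N : ℕ, 0 < N ∧ ∃ k : ℕ → ℕ, gagliardo n s p (fun x =>
      (N : ℝ)⁻¹ • ∑ i ∈ Finset.range N, (v x - v x * η (k i) x)) ≤ ε := by
  have hp0 : 0 < p := by linarith [h.one_le_p]
  -- since `n ≥ 1` and `s ≤ 1`, the condition `n < s p` excludes `p = 1`
  have hp1 : 1 < p := by
    have h1 : (1 : ℝ) ≤ n := by exact_mod_cast h.one_le_n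
    nlinarith [h.s_le_one]
  have hp1' : 1 ≤ ENNReal.ofReal p := by simpa using hp1.le
  have hR : ∀ k : ℕ, (0 : ℝ) < (k : ℝ) + 1 := fun k => by positivity
  by_cases hs : s = 1
  · subst hs
    simp only [gagliardo, if_true] at hfin ⊢
    obtain ⟨G, hG, -, hGp⟩ := exists_isWeakGradient hfin
    set F : ℕ → EuclideanSpace ℝ (Fin n) → EuclideanSpace ℝ (Fin n) := fun k =>
      G - fun x => η k x • G x + v x • gradient (η k) x with hFdef
    have hF : ∀ k, IsWeakGradient (fun x => v x - v x * η k x) (F k) := fun k =>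
      hG.sub (hG.mul_smooth (hη k).contDiff)
    set M := (ENNReal.ofReal ((K * 2 ^ (1 : ℝ) * L) ^ p) *
        volume (Metric.ball (0 : EuclideanSpace ℝ (Fin n)) 1)) ^ (1 / p)
    have hM : M ≠ ⊤ := ENNReal.rpow_ne_top_of_nonneg (by positivity)
      (ENNReal.mul_ne_top ENNReal.ofReal_ne_top measure_ball_lt_top.ne)
    have hbound : ∀ k, eLpNorm (F k) (ENNReal.ofReal p) volume ≤
        eLpNorm G (ENNReal.ofReal p) volume + (eLpNorm G (ENNReal.ofReal p) volume + M) := by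
      intro k
      have m1 : AEStronglyMeasurable (fun x => η k x • G x) volume :=
        (hη k).contDiff.continuous.aestronglyMeasurable.smul hGp.1
      have m2 : AEStronglyMeasurable (fun x => v x • gradient (η k) x) volume :=
        hv.aestronglyMeasurable.smul
          ((InnerProductSpace.toDual ℝ (EuclideanSpace ℝ (Fin n))).symm.continuous.comp
            ((hη k).contDiff.continuous_fderiv (by simp))).aestronglyMeasurable
      refine (eLpNorm_sub_le hGp.1 (m1.add m2) hp1').trans ?_
      gcongr
      refine (eLpNorm_add_le m1 m2 hp1').trans ?_
      gcongr
      · refine eLpNorm_mono fun x => ?_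
        rw [norm_smul, Real.norm_of_nonneg ((hη k).nonneg x)]
        exact mul_le_of_le_one_left (norm_nonneg _) ((hη k).le_one x)
      · exact (hη k).eLpNorm_smul_gradient_le h hsp hL hK hvK (hR k)
    obtain ⟨N, hN, k, hk⟩ := exists_average_eLpNorm_le hp1
      (fun k => (hF k).2.aestronglyMeasurable)
      (ENNReal.add_ne_top.2 ⟨hGp.2.ne, ENNReal.add_ne_top.2 ⟨hGp.2.ne, hM⟩⟩) hbound
      (S := fun k : ℕ => Metric.ball 0 ((k : ℝ) + 1)) (fun _ => measurableSet_ball)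
      (fun a b hab => Metric.ball_subset_ball (by gcongr)) (Metric.iUnion_ball_nat_succ 0)
      (fun k x hx => by
        rw [mem_ball_zero_iff] at hx
        simp [hFdef, (hη k).eq_one x hx.le, (hη k).gradient_eq_zero (Or.inl hx)]) hε
    refine ⟨N, hN, k, ?_⟩
    rwa [gradSeminorm_eq (IsWeakGradient.average (fun i => hF (k i)) _ N)]
  · have hs1 : s < 1 := lt_of_le_of_ne h.s_le_one hs
    set c : ℝ≥0∞ := ENNReal.ofReal (s * (1 - s)) ^ (1 / p) with hcdef
    have hc0 : c ≠ 0 := by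
      have h1 : 0 < s * (1 - s) := mul_pos h.s_pos (sub_pos.2 hs1)
      rw [hcdef, ENNReal.ofReal_rpow_of_pos h1]
      simpa using Real.rpow_pos_of_pos h1 _
    have hct : c ≠ ⊤ := ENNReal.rpow_ne_top_of_nonneg (by positivity) ENNReal.ofReal_ne_top
    have hUfin : eLpNorm (diffQuot n s p v) (ENNReal.ofReal p) volume ≠ ⊤ := by
      rw [gagliardo_eq_eLpNorm_diffQuot hp0 hs, ← hcdef] at hfin
      intro ht
      rw [ht, ENNReal.mul_top hc0] at hfin
      exact lt_irrefl _ hfin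
    have hηc : ∀ k, Continuous fun x => v x * η k x := fun k =>
      hv.mul (hη k).contDiff.continuous
    set M := 2 ^ (p - 1) * (gagliardoIntegral n s p v +
      2 * (ENNReal.ofReal ((K * 2 ^ s * L) ^ p) *
        volume (Metric.ball (0 : EuclideanSpace ℝ (Fin n)) 1) * ∫⁻ x, kernel n s p x))
    have hM : M ≠ ⊤ := by
      refine ENNReal.mul_ne_top (ENNReal.rpow_ne_top_of_nonneg (by linarith) (by simp))
        (ENNReal.add_ne_top.2 ⟨?_, ENNReal.mul_ne_top (by simp) (ENNReal.mul_ne_top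
          (ENNReal.mul_ne_top ENNReal.ofReal_ne_top measure_ball_lt_top.ne)
          (lintegral_kernel_lt_top h hs1).ne)⟩)
      rw [← lintegral_diffQuot hp0, ← eLpNorm_rpow hp0]
      exact ENNReal.rpow_ne_top_of_nonneg hp0.le hUfin
    have hbound : ∀ k, eLpNorm (diffQuot n s p (fun x => v x - v x * η k x)) (ENNReal.ofReal p)
        volume ≤ eLpNorm (diffQuot n s p v) (ENNReal.ofReal p) volume + M ^ (1 / p) := by
      intro k
      have e : (fun x => v x - v x * η k x) = v - fun x => v x * η k x := rfl
      rw [e, diffQuot_sub]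
      refine (eLpNorm_sub_le (measurable_diffQuot hv).aestronglyMeasurable
        (measurable_diffQuot (hηc k)).aestronglyMeasurable hp1').trans ?_
      gcongr
      rw [eLpNorm_le_iff_lintegral hp0, lintegral_diffQuot hp0, ← ENNReal.rpow_mul,
        one_div_mul_cancel hp0.ne', ENNReal.rpow_one]
      exact (hη k).gagliardoIntegral_mul_le h hsp hL hK hv hvK (hR k)
    obtain ⟨N, hN, k, hk⟩ := exists_average_eLpNorm_le hp1
      (fun k => (measurable_diffQuot (hv.sub (hηc k))).aestronglyMeasurable)
      (ENNReal.add_ne_top.2 ⟨hUfin, ENNReal.rpow_ne_top_of_nonneg (by positivity) hM⟩) hbound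
      (S := fun k : ℕ => Metric.ball 0 ((k : ℝ) + 1)) (fun _ => measurableSet_ball)
      (fun a b hab => Metric.ball_subset_ball (by gcongr)) (Metric.iUnion_ball_nat_succ 0)
      (fun k z hz => by
        rw [mem_ball_zero_iff] at hz
        have h1 := (hη k).eq_one z.1 ((norm_fst_le z).trans hz.le)
        have h2 := (hη k).eq_one z.2 ((norm_snd_le z).trans hz.le)
        simp [diffQuot, h1, h2]) (ENNReal.div_ne_zero.2 ⟨hε, hct⟩)
    refine ⟨N, hN, k, ?_⟩
    rw [gagliardo_eq_eLpNorm_diffQuot hp0 hs, ← hcdef, mul_comm,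
      ← ENNReal.le_div_iff_mul_le (Or.inl hc0) (Or.inl hct), diffQuot_average]
    exact hk

theorem exists_hasCompactSupport_gagliardo_sub_le (h : Exponents n s p) (hsp : (n : ℝ) < s * p)
    (hv : MemHolder (s - n / p).toNNReal v) (hv0 : v 0 = 0) (hfin : gagliardo n s p v < ⊤)
    {ε : ℝ≥0∞} (hε : ε ≠ 0) :
    ∃ w, Continuous w ∧ HasCompactSupport w ∧ gagliardo n s p w < ⊤ ∧
      gagliardo n s p (v - w) ≤ ε := by
  have hp0 : 0 < p := by linarith [h.one_le_p]
  have hα := holderExponent_pos h hsp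
  have hvc : Continuous v := continuous_of_memHolder hα hv
  obtain ⟨L, hL, hcut⟩ := exists_isCutoff n
  choose η hη using fun k : ℕ => hcut ((k : ℝ) + 1) (by positivity)
  obtain ⟨K, hK⟩ := hv
  rw [holderWith_iff_norm hα] at hK
  have hvK : ∀ x, ‖v x‖ ≤ K * ‖x‖ ^ (s - n / p) := fun x => by simpa [hv0] using hK x 0
  obtain ⟨N, hN, k, hk⟩ := exists_average_gagliardo_le h hsp hL K.coe_nonneg hvc hvK hfin hη
    -- the minimum with `1` also makes the error finite when `ε = ∞`
    (ε := min ε 1) (by simpa using hε)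
  set w : EuclideanSpace ℝ (Fin n) → ℝ :=
    fun x => (N : ℝ)⁻¹ • ∑ i ∈ Finset.range N, v x * η (k i) x with hw
  have hwc : Continuous w := by
    have hc : ∀ i, Continuous (η (k i)) := fun i => (hη (k i)).contDiff.continuous
    fun_prop
  have hvw : v - w = fun x => (N : ℝ)⁻¹ • ∑ i ∈ Finset.range N, (v x - v x * η (k i) x) := by
    ext x
    have : (N : ℝ) ≠ 0 := by exact_mod_cast hN.ne'
    simp [hw, Finset.sum_sub_distrib, mul_sub, this]
  have hle : gagliardo n s p (v - w) ≤ min ε 1 := by rwa [hvw]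
  refine ⟨w, hwc, ?_, ?_, hle.trans (min_le_left _ _)⟩
  · have hsum : HasCompactSupport fun x => ∑ i ∈ Finset.range N, v x * η (k i) x := by
      have : ∀ M : ℕ, HasCompactSupport fun x => ∑ i ∈ Finset.range M, v x * η (k i) x := by
        intro M
        induction M with
        | zero =>
          simp only [Finset.range_zero, Finset.sum_empty]
          exact HasCompactSupport.zero
        | succ M ih =>
          simp only [Finset.sum_range_succ]
          exact ih.add ((hη (k M)).hasCompactSupport.mul_left)
      exact this N
    exact hsum.smul_left (f := fun _ => (N : ℝ)⁻¹)
  · have e : w = v + -(v - w) := by simp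
    rw [e]
    refine (gagliardo_add_le h.one_le_p hvc (hvc.sub hwc).neg).trans_lt ?_
    rw [gagliardo_neg hp0]
    exact ENNReal.add_lt_top.2 ⟨hfin, hle.trans_lt ((min_le_right _ _).trans_lt (by simp))⟩

/-- Test functions are dense modulo constants. -/
theorem exists_isTest_gagliardo_sub_le_of_memHolder (h : Exponents n s p)
    (hsp : (n : ℝ) < s * p) (hv : MemHolder (s - n / p).toNNReal v) (hv0 : v 0 = 0)
    (hfin : gagliardo n s p v < ⊤) {ε : ℝ≥0∞} (hε : ε ≠ 0) :
    ∃ φ, IsTest φ ∧ gagliardo n s p (v - φ) ≤ ε := by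
  have hε2 : ε / 2 ≠ 0 := by simpa using hε
  obtain ⟨w, hw, hwc, hwfin, hwε⟩ := exists_hasCompactSupport_gagliardo_sub_le h hsp hv hv0 hfin hε2
  obtain ⟨φ, hφ, hφε⟩ := exists_isTest_gagliardo_sub_le h hw hwc hwfin hε2
  refine ⟨φ, hφ, ?_⟩
  have hvc : Continuous v := continuous_of_memHolder (holderExponent_pos h hsp) hv
  rw [← sub_add_sub_cancel v w φ, ← ENNReal.add_halves ε]
  exact (gagliardo_add_le h.one_le_p (hvc.sub hw) (hw.sub hφ.continuous)).trans
    (add_le_add hwε hφε)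

end CutoffApprox

/-! ### The isometric isomorphism -/

section Isometry

variable {n : ℕ} {s p : ℝ} (h : Exponents n s p) (hsp : (n : ℝ) < s * p)

theorem IsTest.memHolder {φ : EuclideanSpace ℝ (Fin n) → ℝ} (hφ : IsTest φ) {α : ℝ} (hα : 0 < α)
    (hα1 : α ≤ 1) : MemHolder α.toNNReal φ := by
  obtain ⟨L, hL⟩ := (hφ.1.of_le (m := 1) (by simp)).lipschitzWith_of_hasCompactSupport hφ.2 (by simp)
  obtain ⟨M, hM⟩ := hφ.2.exists_bound_of_continuous hφ.continuous
  have hM0 : 0 ≤ M := (norm_nonneg _).trans (hM 0)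
  refine ⟨max L (2 * M).toNNReal, (holderWith_iff_norm hα).2 fun x y => ?_⟩
  rw [NNReal.coe_max, Real.coe_toNNReal _ (by positivity)]
  rcases le_total ‖x - y‖ 1 with hxy | hxy
  · calc ‖φ x - φ y‖ ≤ L * ‖x - y‖ := hL.norm_sub_le x y
      _ ≤ max (L : ℝ) (2 * M) * ‖x - y‖ ^ α := by
        gcongr
        · exact le_max_left _ _
        · exact Real.self_le_rpow_of_le_one (norm_nonneg _) hxy hα1
  · calc ‖φ x - φ y‖ ≤ 2 * M := by
          refine (norm_sub_le _ _).trans ?_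
          linarith [hM x, hM y]
      _ ≤ max (L : ℝ) (2 * M) * ‖x - y‖ ^ α := by
        refine (le_max_right _ _).trans (le_mul_of_one_le_right (by positivity) ?_)
        exact Real.one_le_rpow hxy hα.le

/-- The inclusion of the test functions in the space of Hölder functions of finite seminorm. -/
def TestSpace.toHolder : TestSpace n s p h →ₗ[ℝ] holderSubmodule h hsp where
  toFun φ := ⟨φ, IsTest.memHolder φ.2 (holderExponent_pos h hsp) (by
    have h1 : 0 ≤ (n : ℝ) / p := by
      have := h.one_le_p
      positivity
    linarith [h.s_le_one]), IsTest.gagliardo_lt_top h φ.2⟩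
  map_add' _ _ := rfl
  map_smul' _ _ := rfl

/-- The isometry `φ ↦ {φ}_C` from the test functions to the quotient space. -/
def TestSpace.toW : TestSpace n s p h →ₗᵢ[ℝ] W n s p h hsp where
  toLinearMap := (W.mk h hsp).comp (TestSpace.toHolder h hsp)
  norm_map' _ := rfl

theorem TestSpace.denseRange_toW : DenseRange (TestSpace.toW h hsp) := by
  refine Metric.denseRange_iff.2 fun w r hr => ?_
  obtain ⟨f, rfl, hf0⟩ := W.exists_mk_eq h hsp w
  have hr2 : ENNReal.ofReal (r / 2) ≠ 0 := by simpa using hr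
  obtain ⟨φ, hφ, hle⟩ := exists_isTest_gagliardo_sub_le_of_memHolder h hsp f.2.1 hf0 f.2.2 hr2
  refine ⟨(⟨φ, hφ⟩ : testSubmodule n), ?_⟩
  have e : dist (W.mk h hsp f) (TestSpace.toW h hsp (⟨φ, hφ⟩ : testSubmodule n)) =
      (gagliardo n s p (f.1 - φ)).toReal := by
    rw [dist_eq_norm]
    change ‖W.mk h hsp f - W.mk h hsp (TestSpace.toHolder h hsp (⟨φ, hφ⟩ : testSubmodule n))‖ = _
    rw [← map_sub, W.norm_mk]
    rfl
  rw [e]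
  refine (ENNReal.toReal_mono ENNReal.ofReal_ne_top hle).trans_lt ?_
  rw [ENNReal.toReal_ofReal (by positivity)]
  linarith

/-- A linear isometry with dense range into a complete space in which only `0` has norm `0` extends
to a linear isometric isomorphism from the completion. -/
theorem exists_linearIsometryEquiv_completion {E F : Type*} [SeminormedAddCommGroup E]
    [NormedSpace ℝ E] [SeminormedAddCommGroup F] [NormedSpace ℝ F] [CompleteSpace F]
    (hF : ∀ y : F, ‖y‖ = 0 → y = 0) (ι : E →ₗᵢ[ℝ] F) (hι : DenseRange ι) :
    ∃ J : UniformSpace.Completion E ≃ₗᵢ[ℝ] F, ∀ x : E, J x = ι x := by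
  have hT : T0Space F := by
    refine ⟨fun x y hxy => ?_⟩
    have h1 := Metric.inseparable_iff.1 hxy
    rw [dist_eq_norm] at h1
    exact sub_eq_zero.1 (hF _ h1)
  obtain ⟨T, hTι, hTc⟩ : ∃ T : UniformSpace.Completion E → F, (∀ x : E, T x = ι x) ∧ Continuous T :=
    ⟨UniformSpace.Completion.extension ι,
      UniformSpace.Completion.extension_coe ι.isometry.uniformContinuous,
      UniformSpace.Completion.continuous_extension⟩
  have hTn : ∀ x, ‖T x‖ = ‖x‖ := fun x => by
    refine UniformSpace.Completion.induction_on x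
      (isClosed_eq hTc.norm continuous_norm) fun a => ?_
    rw [hTι, ι.norm_map, UniformSpace.Completion.norm_coe]
  have hTadd : ∀ x y, T (x + y) = T x + T y := fun x y => by
    refine UniformSpace.Completion.induction_on₂ x y
      (isClosed_eq (hTc.comp (continuous_fst.add continuous_snd))
        ((hTc.comp continuous_fst).add (hTc.comp continuous_snd))) fun a b => ?_
    rw [← UniformSpace.Completion.coe_add, hTι, hTι, hTι, map_add]
  have hTsmul : ∀ (c : ℝ) x, T (c • x) = c • T x := fun c x => by
    refine UniformSpace.Completion.induction_on x
      (isClosed_eq (hTc.comp (continuous_const_smul c)) (hTc.const_smul c)) fun a => ?_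
    rw [← UniformSpace.Completion.coe_smul, hTι, hTι, map_smul]
  let T' : UniformSpace.Completion E →ₗᵢ[ℝ] F :=
    { toFun := T
      map_add' := hTadd
      map_smul' := hTsmul
      norm_map' := hTn }
  have hiso : Isometry T' := T'.isometry
  have hclosed : IsClosed (Set.range T') := hiso.isUniformInducing.isComplete_range.isClosed
  have hsurj : Function.Surjective T' := by
    rw [← Set.range_eq_univ, ← hclosed.closure_eq]
    refine Dense.closure_eq (hι.mono ?_)
    rintro _ ⟨x, rfl⟩
    exact ⟨x, hTι x⟩
  exact ⟨LinearIsometryEquiv.ofSurjective T' hsurj, hTι⟩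

end Isometry

end HomogeneousSobolev
end

theorem theorem4p3 (n : ℕ) (s p : ℝ) (h : Exponents n s p) (hsp : (n : ℝ) < s * p) :
    -- the quotient space is a Banach space: its seminorm is a norm and it is complete
    (∀ w : W n s p h hsp, ‖w‖ = 0 → w = 0) ∧
    CompleteSpace (W n s p h hsp) ∧
    -- linear isometric isomorphism with the completion, sending a test function to its class
    ∃ J : D n s p h ≃ₗᵢ[ℝ] W n s p h hsp,
      ∀ φ : TestSpace n s p h, ∃ u : holderSubmodule h hsp,
        (u : EuclideanSpace ℝ (Fin n) → ℝ) = φ ∧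
          J (φ : UniformSpace.Completion (TestSpace n s p h)) = W.mk h hsp u := by
  have hcomplete := W.completeSpace h hsp
  obtain ⟨J, hJ⟩ := exists_linearIsometryEquiv_completion (W.eq_zero_of_norm_eq_zero h hsp)
    (TestSpace.toW h hsp) (TestSpace.denseRange_toW h hsp)
  exact ⟨W.eq_zero_of_norm_eq_zero h hsp, hcomplete, J,
    fun φ => ⟨TestSpace.toHolder h hsp φ, rfl, hJ φ⟩⟩
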